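/- Let $m\ge 2$ and $\Sigma=\{\alpha_1,\dots,\alpha_m,\beta_1,\dots,\beta_m\}$. Let $M$ be the monoid with zero generated by $\Sigma$ subject to the relations $\alpha_j\beta_j\equiv 1$ and $\alpha_i\beta_j\equiv 0$ for $i\ne j$, and let $Y\subset\Sigma^{\mathbb N}$ be the one-sided $m$-Dyck shift, i.e. the set of sequences none of whose finite blocks is $\equiv 0 \pmod M$, with the product topology and its Borel sets. The tail relation is $\mathcal T(Y)=\{(y,y')\in Y\times Y:\ \exists n\ \forall k>n\ \ y_k=y'_k\}$. A (nonnegative) Borel measure $\mu$ on $Y$ is tail-invariant if $\mu(A)=\mu(g(A))$ for every Borel set $A\subset Y$ and every injective Borel map $g:A\to Y$ with $(y,g(y))\in\mathcal T(Y)$ for all $y\in A$. It is topologically $\sigma$-finite if for some $\mu$-null set $N$ the set $Y\setminus N$ is covered by countably many open sets of finite $\mu$-measure. It is ergodic if each Borel set that is a union of $\mathcal T(Y)$-classes is null or has null complement. For $y\in Y$ let $H_i(y)=\sum_{j<i}\sum_{l=1}^m(\delta_{\alpha_l,y_j}-\delta_{\beta_l,y_j})$ and $G_-=\{y\in Y:\liminf_{i\to\infty}H_i(y)=-\infty\}$.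 Let $\Theta=\{\beta_1,\dots,\beta_m,\alpha\}^{\mathbb N}$, let $\Theta_-\subset\Theta$ be defined in the same way with $\alpha$ counted as $+1$ and each $\beta_j$ as $-1$, and let Krieger's map $g_-:G_-\to\Theta$ replace every $\alpha_j$ by $\alpha$ and keep every $\beta_j$. Let $p$ be the uniform Bernoulli measure on $\Theta$, giving each letter probability $1/(m+1)$ independently. Then the tail relation of $Y$ is uniquely ergodic: there is exactly one tail-invariant Borel probability measure $\mu$ on $Y$, and it is ergodic. Moreover, up to multiplication by a positive real number there is exactly one nonzero topologically $\sigma$-finite tail-invariant measure: the nonzero topologically $\sigma$-finite tail-invariant measures on $Y$ are exactly the measures $c\mu$ with $0<c<\infty$ (in particular, all of them are finite). Furthermore $\mu(Y\setminus G_-)=0$, the map $g_-$ is a bijection of $G_-$ onto $\Theta_-$, and $\mu$ is the pullback of $p$ under $g_-$, that is, $\mu(A)=p\bigl(g_-(A\cap G_-)\bigr)$ for every Borel set $A\subset Y$. -/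

import Mathlib

open MeasureTheory

namespace Dyck

/-! ### Countable equivalence relations and invariant measures -/

section Relation

variable {X : Type*} [MeasurableSpace X]

/-- A holonomy of the relation `R` with domain `A`: an injective Borel map `g : A → X`, on a
Borel set `A`, with `x` and `g x` being `R`-related for every `x ∈ A`. -/
structure IsHolonomy (R : X → X → Prop) (A : Set X) (g : A → X) : Prop where
  measurableSet : MeasurableSet A
  measurable : Measurable g
  injective : Function.Injective g
  rel : ∀ x : A, R x (g x)

/-- `μ` is invariant under `R`: `μ A = μ (g A)` for every holonomy `g` of `R` with domain `A`. -/
def IsInvariantMeasure (R : X → X → Prop) (μ : Measure X) : Prop :=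
  ∀ (A : Set X) (g : A → X), IsHolonomy R A g → μ A = μ (Set.range g)

/-- `R` is uniquely ergodic: there is exactly one `R`-invariant Borel probability measure. -/
def IsUniquelyErgodic (R : X → X → Prop) : Prop :=
  ∃! μ : Measure X, IsProbabilityMeasure μ ∧ IsInvariantMeasure R μ

/-- `μ` is ergodic for `R`: every Borel set that is saturated under `R` is null or conull. -/
def IsErgodicMeasure (R : X → X → Prop) (μ : Measure X) : Prop :=
  ∀ A : Set X, MeasurableSet A → (∀ x y, R x y → (x ∈ A ↔ y ∈ A)) → μ A = 0 ∨ μ Aᶜ = 0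

/-- `μ` is topologically `σ`-finite: outside a `μ`-null set `N` the space is covered by countably
many open sets of finite measure. -/
def IsTopologicallySigmaFinite [TopologicalSpace X] (μ : Measure X) : Prop :=
  ∃ N : Set X, μ N = 0 ∧ ∃ U : ℕ → Set X,
    (∀ n, IsOpen (U n) ∧ μ (U n) < ⊤) ∧ Nᶜ ⊆ ⋃ n, U n

end Relation

/-! ### The Dyck shift -/

/-- The alphabet `{α₁, …, αₘ, β₁, …, βₘ}`, with the discrete topology. -/
inductive Letter (m : ℕ) : Type
  | α (j : Fin m) : Letter m
  | β (j : Fin m) : Letter m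

/-- The alphabet `{β₁, …, βₘ, α}`, with the discrete topology. -/
inductive ThetaLetter (m : ℕ) : Type
  | α : ThetaLetter m
  | β (j : Fin m) : ThetaLetter m

variable {m : ℕ}

instance : TopologicalSpace (Letter m) := ⊥
instance : DiscreteTopology (Letter m) := ⟨rfl⟩
instance : MeasurableSpace (Letter m) := ⊤
instance : DiscreteMeasurableSpace (Letter m) := ⟨fun _ => trivial⟩

/-- The `2m` letters listed as `Fin m ⊕ Fin m`. -/
def letterEquiv (m : ℕ) : Fin m ⊕ Fin m ≃ Letter m where
  toFun := Sum.elim Letter.α Letter.β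
  invFun
    | .α j => Sum.inl j
    | .β j => Sum.inr j
  left_inv x := by cases x <;> rfl
  right_inv x := by cases x <;> rfl

instance : Fintype (Letter m) := Fintype.ofEquiv _ (letterEquiv m)

instance : TopologicalSpace (ThetaLetter m) := ⊥
instance : DiscreteTopology (ThetaLetter m) := ⟨rfl⟩
instance : MeasurableSpace (ThetaLetter m) := ⊤
instance : DiscreteMeasurableSpace (ThetaLetter m) := ⟨fun _ => trivial⟩

/-- The `m + 1` letters listed as `Option (Fin m)`. -/
def thetaLetterEquiv (m : ℕ) : Option (Fin m) ≃ ThetaLetter m where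
  toFun
    | none => .α
    | some j => .β j
  invFun
    | .α => none
    | .β j => some j
  left_inv x := by cases x <;> rfl
  right_inv x := by cases x <;> rfl

instance : Fintype (ThetaLetter m) := Fintype.ofEquiv _ (thetaLetterEquiv m)
instance : Nonempty (ThetaLetter m) := ⟨.α⟩

/-- A word, as an element of the free monoid with zero on the alphabet. -/
def wordClass (w : List (Letter m)) : WithZero (FreeMonoid (Letter m)) :=
  ((FreeMonoid.ofList w : FreeMonoid (Letter m)) : WithZero (FreeMonoid (Letter m)))

/-- The defining relations `αⱼ βⱼ ≡ 1` and `αᵢ βⱼ ≡ 0` for `i ≠ j`. -/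
inductive DefiningRel (m : ℕ) :
    WithZero (FreeMonoid (Letter m)) → WithZero (FreeMonoid (Letter m)) → Prop
  | matched (j : Fin m) : DefiningRel m (wordClass [.α j, .β j]) 1
  | mismatched (i j : Fin m) (h : i ≠ j) : DefiningRel m (wordClass [.α i, .β j]) 0

/-- Congruence modulo the Dyck monoid `M`, the monoid with zero generated by the letters subject
to the defining relations. -/
def monoidCon (m : ℕ) : Con (WithZero (FreeMonoid (Letter m))) := conGen (DefiningRel m)

/-- The `m`-Dyck language: the words that are not `≡ 0` modulo the Dyck monoid. -/
def language (m : ℕ) : Set (List (Letter m)) :=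
  {w | ¬ monoidCon m (wordClass w) 0}

/-- The one-sided `m`-Dyck shift: the sequences all of whose finite blocks
`y r, …, y (r + n - 1)` lie in the Dyck language. It carries the subspace topology and Borel
structure of the product space `ℕ → Letter m`. -/
def OneSidedShift (m : ℕ) : Set (ℕ → Letter m) :=
  {y | ∀ r n : ℕ, (List.range n).map (fun i => y (r + i)) ∈ language m}

/-- The tail relation of the one-sided Dyck shift. -/
def TailRel (m : ℕ) (y y' : OneSidedShift m) : Prop :=
  ∃ n : ℕ, ∀ k > n, y.1 k = y'.1 k

/-- The increment of the height at a letter: `+1` at each `αⱼ`, `-1` at each `βⱼ`. -/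
def Letter.height : Letter m → ℤ
  | .α _ => 1
  | .β _ => -1

/-- The height `H_i(y) = ∑_{j < i} (±1)`. -/
def height (y : ℕ → Letter m) (i : ℕ) : ℤ := ∑ j ∈ Finset.range i, (y j).height

/-- `G₋ = {y : liminf H_i(y) = -∞}`, the liminf being taken in the extended reals. -/
def Gminus (m : ℕ) : Set (OneSidedShift m) :=
  {y | Filter.liminf (fun i => ((height y.1 i : ℝ) : EReal)) Filter.atTop = ⊥}

/-- `+1` at `α`, `-1` at each `βⱼ`. -/
def ThetaLetter.height : ThetaLetter m → ℤ
  | .α => 1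
  | .β _ => -1

/-- The height on the full shift `{β₁, …, βₘ, α}^ℕ`. -/
def thetaHeight (x : ℕ → ThetaLetter m) (i : ℕ) : ℤ := ∑ j ∈ Finset.range i, (x j).height

/-- `Θ₋ = {x : liminf H̃_i(x) = -∞}`. -/
def ThetaMinus (m : ℕ) : Set (ℕ → ThetaLetter m) :=
  {x | Filter.liminf (fun i => ((thetaHeight x i : ℝ) : EReal)) Filter.atTop = ⊥}

/-- Forget the index of an `α`, keep that of a `β`. -/
def Letter.forget : Letter m → ThetaLetter m
  | .α _ => .α
  | .β j => .β j

/-- Krieger's map `g₋`, given by the letterwise formula on the whole one-sided shift; it is used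
only on `G₋`. -/
def kriegerMap (m : ℕ) (y : OneSidedShift m) : ℕ → ThetaLetter m :=
  fun i => (y.1 i).forget

/-- The uniform (symmetric) Bernoulli measure on `{β₁, …, βₘ, α}^ℕ`: the product of the uniform
distributions on the `m + 1` letters. -/
noncomputable def bernoulli (m : ℕ) : Measure (ℕ → ThetaLetter m) :=
  Measure.infinitePi fun _ : ℕ => (PMF.uniformOfFintype (ThetaLetter m)).toMeasure

end Dyck

open scoped ENNReal

namespace Dyck

variable {m : ℕ}

/-! ### Words and stacks -/

/-! Words act on stacks of indices: an `α` pushes its index, a `β` pops the top and kills the stack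
if the indices differ. A word is zero in the Dyck monoid exactly if it kills the empty stack
(`mem_language_iff`), so a sequence lies in the shift exactly if the two ends of each balanced block
of its height path carry the same index (`mem_shift_iff`).

If the height is unbounded below, every `α` is matched by a later `β`, which reveals its index.
Hence Krieger's map loses nothing on `Gminus`, and its inverse labels each `α` from its match
(`bijOn_kriegerMap`). A label depends only on the letters from its position on (`label_congr`), so
prefixes can be exchanged below in the full shift and the result lifted without leaving the tail
class.

Invariant measures are confined to `Gminus` in two steps. Some open set of finite measure contains a
cylinder whose prefix can be extended until it ends at its lowest height; such a prefix may replace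
any other of its length, which bounds the total mass
(`isFiniteMeasure_of_isTopologicallySigmaFinite`). Where the height has a minimum, turning an `α`
that leaves this minimum into the `β` of the same index is an injective tail move to a smaller
minimum. Iterating it gives infinitely many disjoint sets of no smaller measure, so the original set
is null (`measure_compl_Gminus`).

On `Gminus`, exchanging prefixes shows that the image measure gives equal mass to all cylinders of
one length, so it is a multiple of the uniform Bernoulli measure: this is uniqueness
(`IsInvariantMeasure.eq_smul_dyckMeasure`). For existence, the drift is negative as `2 ≤ m`, so
`ThetaMinus` has full measure (`bernoulli_compl_ThetaMinus`), and each holonomy is a countable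
patchwork of prefix exchanges (`isInvariantMeasure_dyckMeasure`). Ergodicity is uniqueness applied
to the restriction to a saturated set. -/

/-- One step of the stack automaton of the Dyck language. -/
def stackStep : Option (List (Fin m)) → Letter m → Option (List (Fin m))
  | none, _ => none
  | some s, .α j => some (j :: s)
  | some [], .β _ => some []
  | some (i :: s), .β j => if i = j then some s else none

/-- The action of the free monoid with zero on stacks. -/
def stackAct : WithZero (FreeMonoid (Letter m)) → Option (List (Fin m)) → Option (List (Fin m))
  | none, _ => none
  | some w, s => (FreeMonoid.toList w).foldl stackStep s

lemma foldl_stackStep_none (w : List (Letter m)) : w.foldl stackStep none = none := by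
  induction w with
  | nil => rfl
  | cons a w ih => exact ih

lemma stackAct_zero (s : Option (List (Fin m))) : stackAct 0 s = none := rfl

lemma stackAct_coe (w : FreeMonoid (Letter m)) (s : Option (List (Fin m))) :
    stackAct (w : WithZero (FreeMonoid (Letter m))) s = (FreeMonoid.toList w).foldl stackStep s :=
  rfl

lemma stackAct_mul (x y : WithZero (FreeMonoid (Letter m))) (s : Option (List (Fin m))) :
    stackAct (x * y) s = stackAct y (stackAct x s) := by
  induction x using WithZero.recZeroCoe with
  | zero =>
    rw [zero_mul, stackAct_zero]
    induction y using WithZero.recZeroCoe with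
    | zero => rfl
    | coe y => exact (foldl_stackStep_none _).symm
  | coe x =>
    induction y using WithZero.recZeroCoe with
    | zero => rw [mul_zero]; rfl
    | coe y =>
      rw [← WithZero.coe_mul, stackAct_coe, stackAct_coe, stackAct_coe, FreeMonoid.toList_mul,
        List.foldl_append]

/-- The congruence of acting in the same way on stacks. -/
def stackCon (m : ℕ) : Con (WithZero (FreeMonoid (Letter m))) where
  r x y := stackAct x = stackAct y
  iseqv := ⟨fun _ => rfl, fun h => h.symm, fun h h' => h.trans h'⟩
  mul' {a b c d} h h' := by
    funext s
    rw [stackAct_mul, stackAct_mul]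
    exact (congrFun h' _).trans (congrArg _ (congrFun h s))

/-- It suffices to check the generators: pushing `j` and popping `j` does nothing, pushing `i` and
popping `j ≠ i` kills. This is what certifies that a word is not zero. -/
lemma monoidCon_le_stackCon : monoidCon m ≤ stackCon m := by
  refine Con.conGen_le.2 ?_
  intro x y h
  change stackAct x = stackAct y
  funext s
  cases h with
  | matched j =>
    change stackStep (stackStep s (.α j)) (.β j) = s
    cases s <;> simp [stackStep]
  | mismatched i j h =>
    change stackStep (stackStep s (.α i)) (.β j) = none
    cases s <;> simp [stackStep, h]

lemma wordClass_append (u v : List (Letter m)) :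
    wordClass (u ++ v) = wordClass u * wordClass v := by
  simp [wordClass]

lemma monoidCon_zero_append_right {u : List (Letter m)} (h : monoidCon m (wordClass u) 0)
    (v : List (Letter m)) : monoidCon m (wordClass (u ++ v)) 0 := by
  rw [wordClass_append]
  simpa using (monoidCon m).mul h ((monoidCon m).refl (wordClass v))

lemma monoidCon_zero_append_left {u : List (Letter m)} (h : monoidCon m (wordClass u) 0)
    (v : List (Letter m)) : monoidCon m (wordClass (v ++ u)) 0 := by
  rw [wordClass_append]
  simpa using (monoidCon m).mul ((monoidCon m).refl (wordClass v)) h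

/-- Reduction to normal form, letter by letter from the left. A nonzero word reduces to a run of
`β`s followed by a run of `α`s; the stack holds the `α`s, last one on top (hence `reverse`), and
forgets the `β`s. -/
lemma monoidCon_reduced (w : List (Letter m)) :
    (∀ s, w.foldl stackStep (some []) = some s → ∃ b : List (Fin m),
      monoidCon m (wordClass w) (wordClass (b.map .β ++ s.reverse.map .α))) ∧
    (w.foldl stackStep (some []) = none → monoidCon m (wordClass w) 0) := by
  induction w using List.reverseRecOn with
  | nil =>
    refine ⟨?_, by simp⟩
    intro s hs
    obtain rfl : s = [] := by simpa using hs.symm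
    exact ⟨[], (monoidCon m).refl _⟩
  | append_singleton w a ih =>
    rw [List.foldl_append, List.foldl_cons, List.foldl_nil]
    rcases hw : w.foldl stackStep (some []) with _ | s
    · exact ⟨by simp [stackStep], fun _ => monoidCon_zero_append_right (ih.2 hw) _⟩
    obtain ⟨b, hb⟩ := ih.1 s hw
    have key : monoidCon m (wordClass (w ++ [a]))
        (wordClass (b.map .β ++ s.reverse.map .α ++ [a])) := by
      rw [wordClass_append, wordClass_append _ [a]]
      exact (monoidCon m).mul hb ((monoidCon m).refl _)
    rcases a with j | j
    · refine ⟨?_, by simp [stackStep]⟩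
      intro t ht
      obtain rfl : j :: s = t := by simpa [stackStep] using ht
      exact ⟨b, by simpa using key⟩
    rcases s with _ | ⟨i, s⟩
    · refine ⟨?_, by simp [stackStep]⟩
      intro t ht
      obtain rfl : [] = t := by simpa [stackStep] using ht
      exact ⟨b ++ [j], by simpa using key⟩
    have split : b.map .β ++ (i :: s).reverse.map .α ++ [.β j]
        = (b.map .β ++ s.reverse.map .α) ++ ([.α i, .β j] : List (Letter m)) := by simp
    rw [split, wordClass_append _ [_, _]] at key
    by_cases hij : i = j
    · subst hij
      refine ⟨?_, by simp [stackStep]⟩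
      intro t ht
      obtain rfl : s = t := by simpa [stackStep] using ht
      refine ⟨b, (monoidCon m).trans key ?_⟩
      simpa using (monoidCon m).mul ((monoidCon m).refl (wordClass (b.map .β ++ s.reverse.map .α)))
        (ConGen.Rel.of _ _ (DefiningRel.matched i) : monoidCon m _ _)
    · refine ⟨by simp [stackStep, hij], fun _ => (monoidCon m).trans key ?_⟩
      simpa using (monoidCon m).mul ((monoidCon m).refl (wordClass (b.map .β ++ s.reverse.map .α)))
        (ConGen.Rel.of _ _ (DefiningRel.mismatched i j hij) : monoidCon m _ _)

lemma mem_language_iff (w : List (Letter m)) :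
    w ∈ language m ↔ w.foldl stackStep (some []) ≠ none := by
  refine ⟨fun h h' => h ((monoidCon_reduced w).2 h'), fun h h' => h ?_⟩
  exact congrFun (monoidCon_le_stackCon h' : stackAct _ = stackAct 0) (some [])

/-- The stack after reading the first `n` letters. -/
def stackAt (y : ℕ → Letter m) : ℕ → Option (List (Fin m))
  | 0 => some []
  | n + 1 => stackStep (stackAt y n) (y n)

lemma foldl_range_eq_stackAt (y : ℕ → Letter m) (n : ℕ) :
    ((List.range n).map y).foldl stackStep (some []) = stackAt y n := by
  induction n with
  | zero => rfl
  | succ n ih => rw [List.range_succ, List.map_append, List.foldl_append, ih]; rfl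

/-- Prefixes suffice: a block is the end of a prefix, and zero is absorbing. -/
lemma mem_shift_iff_stackAt (y : ℕ → Letter m) :
    y ∈ OneSidedShift m ↔ ∀ n, stackAt y n ≠ none := by
  constructor
  · intro h n
    have := (mem_language_iff _).1 (h 0 n)
    simpa [← foldl_range_eq_stackAt] using this
  · intro h r n hn
    refine h (r + n) ?_
    rw [← foldl_range_eq_stackAt, ← not_ne_iff, ← mem_language_iff]
    refine not_not.2 ?_
    have := monoidCon_zero_append_left hn ((List.range r).map y)
    rwa [List.range_add, List.map_append, List.map_map]

/-! ### Heights and matching -/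

lemma height_succ (y : ℕ → Letter m) (i : ℕ) :
    height y (i + 1) = height y i + (y i).height := Finset.sum_range_succ _ _

lemma thetaHeight_succ (x : ℕ → ThetaLetter m) (i : ℕ) :
    thetaHeight x (i + 1) = thetaHeight x i + (x i).height := Finset.sum_range_succ _ _

@[simp] lemma height_zero (y : ℕ → Letter m) : height y 0 = 0 := rfl

@[simp] lemma height_α (j : Fin m) : (Letter.α j).height = 1 := rfl

@[simp] lemma height_β (j : Fin m) : (Letter.β j).height = -1 := rfl

/-- The positions `i < k` are the two ends of a balanced block of the path `h`. -/
def IsMatch (h : ℕ → ℤ) (i k : ℕ) : Prop :=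
  i < k ∧ h (k + 1) = h i ∧ ∀ t, i < t → t ≤ k → h i < h t

lemma IsMatch.right_unique {h : ℕ → ℤ} {i k k' : ℕ} (hk : IsMatch h i k) (hk' : IsMatch h i k') :
    k = k' := by
  obtain ⟨h1, h2, h3⟩ := hk
  obtain ⟨h1', h2', h3'⟩ := hk'
  by_contra hne
  rcases Nat.lt_or_gt_of_ne hne with hlt | hlt
  · have := h3' (k + 1) (by omega) (by omega); omega
  · have := h3 (k' + 1) (by omega) (by omega); omega

lemma IsMatch.left_unique {h : ℕ → ℤ} {i i' k : ℕ} (hi : IsMatch h i k) (hi' : IsMatch h i' k) :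
    i = i' := by
  obtain ⟨h1, h2, h3⟩ := hi
  obtain ⟨h1', h2', h3'⟩ := hi'
  by_contra hne
  rcases Nat.lt_or_gt_of_ne hne with hlt | hlt
  · have := h3 i' (by omega) (by omega); omega
  · have := h3' i (by omega) (by omega); omega

lemma IsMatch.congr_add {h h' : ℕ → ℤ} {n i k : ℕ} {c : ℤ} (hn : n ≤ i)
    (hc : ∀ t, n ≤ t → h' t = h t + c) : IsMatch h' i k ↔ IsMatch h i k := by
  unfold IsMatch
  refine and_congr_right fun hik => ?_
  rw [hc i hn, hc (k + 1) (by omega), add_left_inj]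
  refine and_congr_right fun _ => forall_congr' fun t => forall_congr' fun ht => ?_
  rw [hc t (by omega)]
  simp

lemma IsMatch.congr_le {h h' : ℕ → ℤ} {n i k : ℕ} (hn : k < n)
    (hc : ∀ t, t ≤ n → h' t = h t) : IsMatch h' i k ↔ IsMatch h i k := by
  unfold IsMatch
  refine and_congr_right fun hik => ?_
  rw [hc i (by omega), hc (k + 1) (by omega)]
  refine and_congr_right fun _ => forall_congr' fun t => forall_congr' fun ht =>
    forall_congr' fun ht' => ?_
  rw [hc t (by omega)]

/-- The index of a letter. -/
def Letter.index : Letter m → Fin m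
  | .α j => j
  | .β j => j

lemma IsMatch.left_α {y : ℕ → Letter m} {i k : ℕ} (h : IsMatch (height y) i k) :
    y i = .α (y i).index := by
  have := h.2.2 (i + 1) (by omega) h.1
  rw [height_succ] at this
  rcases hy : y i with j | j
  · rfl
  · simp [hy] at this

lemma IsMatch.right_β {y : ℕ → Letter m} {i k : ℕ} (h : IsMatch (height y) i k) :
    y k = .β (y k).index := by
  have := h.2.2 k h.1 le_rfl
  rw [← h.2.1, height_succ] at this
  rcases hy : y k with j | j
  · simp [hy] at this
  · rfl

/-- A path that does not drop below its level at `i + 1` never pops the entry pushed just before;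
the part of the stack above that entry measures the excess height. -/
lemma stackAt_between {y : ℕ → Letter m} (hy : ∀ n, stackAt y n ≠ none) {i k : ℕ} {j : Fin m}
    {s : List (Fin m)} (hs : stackAt y (i + 1) = some (j :: s))
    (h : ∀ t, i < t → t ≤ k → height y (i + 1) ≤ height y t) (t : ℕ) (hit : i < t) (htk : t ≤ k) :
    ∃ u : List (Fin m), stackAt y t = some (u ++ j :: s) ∧
      (u.length : ℤ) = height y t - height y (i + 1) := by
  induction t, hit using Nat.le_induction with
  | base => exact ⟨[], hs, by simp⟩
  | succ t hit ih =>
    obtain ⟨u, hu, hl⟩ := ih (by omega)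
    have hlow := h (t + 1) (by omega) htk
    have hne := hy (t + 1)
    rw [stackAt, hu] at hne ⊢
    rw [height_succ y t] at hlow ⊢
    rcases hyt : y t with l | l
    · exact ⟨l :: u, by simp [stackStep], by rw [height_α]; push_cast [List.length_cons]; omega⟩
    · rw [hyt] at hne hlow
      rcases u with _ | ⟨c, u⟩
      · simp at hl hlow; omega
      · by_cases hcl : c = l
        · exact ⟨u, by simp [stackStep, hcl], by
            rw [height_β]; push_cast [List.length_cons] at hl; omega⟩
        · exact absurd (by simp [stackStep, hcl]) hne

/-- The invariant carried through the induction: each stack entry comes from an `α` still open at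
time `n`, and its depth is read off the heights. A `β` that pops the top therefore closes a match
with that `α`, and the hypothesis makes the indices agree. -/
lemma stackAt_of_match {y : ℕ → Letter m}
    (hy : ∀ i k, IsMatch (height y) i k → (y i).index = (y k).index) (n : ℕ) :
    ∃ s, stackAt y n = some s ∧ ∀ (u : List (Fin m)) (j : Fin m) (v : List (Fin m)),
      s = u ++ j :: v → ∃ i < n, y i = .α j ∧ height y n = height y i + u.length + 1 ∧
        ∀ t, i < t → t ≤ n → height y i < height y t := by
  induction n with
  | zero => exact ⟨[], rfl, by simp⟩
  | succ n ih =>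
    obtain ⟨s, hs, h⟩ := ih
    rw [stackAt, hs]
    have hH := height_succ y n
    rcases hyn : y n with j | j <;> rw [hyn] at hH
    · refine ⟨j :: s, rfl, ?_⟩
      intro u j' v huv
      rcases u with _ | ⟨c, u⟩
      · simp only [List.nil_append, List.cons.injEq] at huv
        refine ⟨n, by omega, by rw [hyn, huv.1], by simp [hH], ?_⟩
        intro t h1 h2
        obtain rfl : t = n + 1 := by omega
        simp [hH]
      · simp only [List.cons_append, List.cons.injEq] at huv
        obtain ⟨i, hi, h1, h2, h3⟩ := h u j' v huv.2
        refine ⟨i, by omega, h1, by rw [hH, h2]; simp; ring, ?_⟩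
        intro t ht1 ht2
        rcases Nat.lt_or_ge n t with hnt | hnt
        · obtain rfl : t = n + 1 := by omega
          simp [hH]; omega
        · exact h3 t ht1 hnt
    · rcases s with _ | ⟨c, s⟩
      · exact ⟨[], rfl, by simp⟩
      obtain ⟨i, hi, h1, h2, h3⟩ := h [] c s rfl
      have hm : IsMatch (height y) i n := ⟨hi, by simp [hH, h2], h3⟩
      have hcj : c = j := by simpa [h1, hyn, Letter.index] using hy i n hm
      refine ⟨s, by simp [stackStep, hcj], ?_⟩
      intro u j' v huv
      obtain ⟨i, hi, h1, h2, h3⟩ := h (c :: u) j' v (by simp [huv])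
      refine ⟨i, by omega, h1, by rw [hH, h2]; simp; ring, ?_⟩
      intro t ht1 ht2
      rcases Nat.lt_or_ge n t with hnt | hnt
      · obtain rfl : t = n + 1 := by omega
        rw [hH, h2]; simp
      · exact h3 t ht1 hnt

/-- A sequence is in the Dyck shift exactly if matched letters have equal indices. -/
theorem mem_shift_iff (y : ℕ → Letter m) : y ∈ OneSidedShift m ↔
    ∀ i k, IsMatch (height y) i k → (y i).index = (y k).index := by
  rw [mem_shift_iff_stackAt]
  refine ⟨?_, fun hy n => ?_⟩
  · intro hy i k h
    obtain ⟨s, hs⟩ := Option.ne_none_iff_exists'.1 (hy i)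
    have hi := h.left_α
    have hk := h.right_β
    have hHi : height y (i + 1) = height y i + 1 := by rw [height_succ, hi]; rfl
    have hHk : height y (k + 1) = height y k - 1 := by rw [height_succ, hk]; rfl
    have hs' : stackAt y (i + 1) = some ((y i).index :: s) := by rw [stackAt, hs, hi]; rfl
    obtain ⟨u, hu, hl⟩ := stackAt_between hy hs'
      (fun t h1 h2 => by have := h.2.2 t h1 h2; omega) k h.1 le_rfl
    -- The heights at `i + 1` and `k` agree, so the entry pushed at `i` is on top when `k` is read.
    have : u = [] := by
      rw [← List.length_eq_zero_iff]
      have := h.2.1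
      omega
    subst this
    have hne := hy (k + 1)
    rw [stackAt, hu, hk] at hne
    by_contra hij
    exact hne (by simp [stackStep, hij])
  · obtain ⟨s, hs, -⟩ := stackAt_of_match hy n
    simp [hs]

/-! ### Changing a finite part of a sequence -/

/-- The sequence that starts with the first `n` terms of `w` and continues like `x`. -/
def splice {L : Type*} (n : ℕ) (w x : ℕ → L) : ℕ → L := fun k => if k < n then w k else x k

lemma splice_of_lt {L : Type*} {n k : ℕ} (w x : ℕ → L) (h : k < n) : splice n w x k = w k :=
  if_pos h

lemma splice_of_le {L : Type*} {n k : ℕ} (w x : ℕ → L) (h : n ≤ k) : splice n w x k = x k :=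
  if_neg (by omega)

lemma height_congr_le {y y' : ℕ → Letter m} {n t : ℕ} (h : ∀ k < n, y k = y' k) (ht : t ≤ n) :
    height y t = height y' t :=
  Finset.sum_congr rfl fun k hk => by
    rw [h k ((Finset.mem_range.1 hk).trans_le ht)]

lemma height_congr_ge {y y' : ℕ → Letter m} {n : ℕ} (h : ∀ k ≥ n, y k = y' k) (t : ℕ)
    (ht : n ≤ t) : height y t = height y' t + (height y n - height y' n) := by
  induction t, ht using Nat.le_induction with
  | base => ring
  | succ t ht ih => rw [height_succ, height_succ, ih, h t ht]; ring

lemma thetaHeight_congr_ge {x x' : ℕ → ThetaLetter m} {n : ℕ} (h : ∀ k ≥ n, x k = x' k) (t : ℕ)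
    (ht : n ≤ t) : thetaHeight x t = thetaHeight x' t + (thetaHeight x n - thetaHeight x' n) := by
  induction t, ht using Nat.le_induction with
  | base => ring
  | succ t ht ih => rw [thetaHeight_succ, thetaHeight_succ, ih, h t ht]; ring

lemma height_succ_bounds (y : ℕ → Letter m) (i : ℕ) :
    height y i - 1 ≤ height y (i + 1) ∧ height y (i + 1) ≤ height y i + 1 := by
  rw [height_succ]
  rcases y i with j | j
  · rw [height_α]; omega
  · rw [height_β]; omega

lemma height_bounds (y : ℕ → Letter m) (i : ℕ) : -(i : ℤ) ≤ height y i ∧ height y i ≤ i := by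
  induction i with
  | zero => simp
  | succ i ih => have := height_succ_bounds y i; push_cast; omega

/-- An admissible prefix which ends at its lowest height can be followed by any sequence of which
the shift contains a continuation from there. -/
lemma mem_shift_of_prefix {y y' : ℕ → Letter m} {n : ℕ} (hy : y ∈ OneSidedShift m)
    (hag : ∀ k ≥ n, y' k = y k)
    (hpre : ∀ i k, k < n → IsMatch (height y') i k → (y' i).index = (y' k).index)
    (hmin : ∀ i ≤ n, height y' n ≤ height y' i) : y' ∈ OneSidedShift m := by
  rw [mem_shift_iff] at hy ⊢
  intro i k hik
  rcases Nat.lt_or_ge k n with hk | hk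
  · exact hpre i k hk hik
  rcases Nat.lt_or_ge i n with hi | hi
  -- No match straddles `n`: it would need a height at `n` above that at `i`.
  · have := hik.2.2 n hi hk
    have := hmin i hi.le
    omega
  · rw [hag i hi, hag k hk]
    exact hy i k ((IsMatch.congr_add hi (height_congr_ge hag)).1 hik)

lemma splice_mem_shift {w y : ℕ → Letter m} {n : ℕ} (hy : y ∈ OneSidedShift m)
    (hw : w ∈ OneSidedShift m) (hmin : ∀ i ≤ n, height w n ≤ height w i) :
    splice n w y ∈ OneSidedShift m := by
  have hH : ∀ t ≤ n, height (splice n w y) t = height w t := fun t ht =>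
    height_congr_le (fun k hk => splice_of_lt w y hk) ht
  refine mem_shift_of_prefix hy (fun k hk => splice_of_le w y hk) ?_ ?_
  · intro i k hk hik
    rw [splice_of_lt w y hk, splice_of_lt w y (hik.1.trans hk)]
    exact (mem_shift_iff w).1 hw i k ((IsMatch.congr_le hk hH).1 hik)
  · intro i hi
    rw [hH n le_rfl, hH i hi]
    exact hmin i hi

/-- Every prefix in the shift can be continued to a prefix which ends at its lowest height. -/
lemma exists_closing {y : ℕ → Letter m} (hy : y ∈ OneSidedShift m) (n : ℕ) :
    ∃ w ∈ OneSidedShift m, (∀ k < n, w k = y k) ∧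
      ∃ N ≥ n, ∀ i ≤ N, height w N ≤ height w i := by
  classical
  -- The continuation consists of `β`s only, so its heights are known before its indices. Matches
  -- are computed from `h`, which avoids circularity; an unmatched `β` may have any index, here that
  -- of `y 0`.
  let h : ℕ → ℤ := fun t => if t ≤ n then height y t else height y n - (t - n : ℕ)
  let w : ℕ → Letter m := fun k => if k < n then y k else
    .β (if H : ∃ i, IsMatch h i k then (y H.choose).index else (y 0).index)
  have hw : ∀ k < n, w k = y k := fun k hk => if_pos hk
  have hwn : ∀ k, n ≤ k → w k =
      .β (if H : ∃ i, IsMatch h i k then (y H.choose).index else (y 0).index) :=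
    fun k hk => if_neg (by omega)
  have hlow : ∀ t ≤ n, height w t = height y t := fun t ht => height_congr_le hw ht
  have hhigh : ∀ t, n ≤ t → height w t = height y n - (t - n : ℕ) := by
    intro t ht
    induction t, ht using Nat.le_induction with
    | base => simp [hlow]
    | succ t ht ih =>
      rw [height_succ, ih, hwn t ht, height_β, Nat.succ_sub ht]
      push_cast
      ring
  have hh : height w = h := by
    funext t
    by_cases ht : t ≤ n
    · simp only [h, if_pos ht, hlow t ht]
    · simp only [h, if_neg ht, hhigh t (by omega)]
  -- The first `n` heights are at least `-n` and the height at `n` is at most `n`; `2 * n` further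
  -- descents bring it to `-n` or below.
  refine ⟨w, (mem_shift_iff w).2 ?_, hw, 3 * n, by omega, ?_⟩
  · intro i k hik
    rcases Nat.lt_or_ge k n with hk | hk
    · rw [hw k hk, hw i (hik.1.trans hk)]
      exact (mem_shift_iff y).1 hy i k ((IsMatch.congr_le hk hlow).1 hik)
    have hin : i < n := by
      by_contra hi
      have h1 := hik.left_α
      rw [hwn i (by omega)] at h1
      exact absurd h1 (by simp)
    rw [hh] at hik
    have H : ∃ i, IsMatch h i k := ⟨i, hik⟩
    rw [hw i hin, hwn k hk, dif_pos H, hik.left_unique H.choose_spec]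
    rfl
  · intro i hi
    have hb := height_bounds y n
    rw [hhigh _ (by omega)]
    rcases Nat.lt_or_ge n i with hn | hn
    · rw [hhigh _ hn.le]; omega
    · rw [hlow i hn]
      have := height_bounds y i
      omega

/-- A letter `αⱼ` at the end of a lowest prefix may be replaced by `βⱼ`. -/
lemma flip_mem_shift {y y' : ℕ → Letter m} {n : ℕ} {j : Fin m} (hy : y ∈ OneSidedShift m)
    (hmin : ∀ i ≤ n, height y n ≤ height y i) (hn : y n = .α j) (hn' : y' n = .β j)
    (hne : ∀ k, k ≠ n → y' k = y k) :
    y' ∈ OneSidedShift m ∧ (∀ t ≤ n, height y' t = height y t) ∧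
      ∀ t, n < t → height y' t = height y t - 2 := by
  have hlow : ∀ t ≤ n, height y' t = height y t := fun t ht =>
    height_congr_le (fun k hk => hne k (by omega)) ht
  have hag : ∀ k ≥ n + 1, y' k = y k := fun k hk => hne k (by omega)
  have hs : height y' (n + 1) = height y n - 1 := by
    rw [height_succ, hlow n le_rfl, hn']; rfl
  have hs' : height y (n + 1) = height y n + 1 := by
    rw [height_succ, hn]; rfl
  refine ⟨mem_shift_of_prefix hy hag ?_ ?_, hlow, ?_⟩
  · intro i k hk hik
    rcases Nat.lt_or_ge k n with hkn | hkn
    · rw [hne k (by omega), hne i (by have := hik.1; omega)]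
      exact (mem_shift_iff y).1 hy i k ((IsMatch.congr_le hkn hlow).1 hik)
    -- The new `β` goes strictly below all earlier heights, so it is unmatched.
    · obtain rfl : k = n := by omega
      have := hik.2.1
      have := hmin i hik.1.le
      have := hlow i hik.1.le
      omega
  · intro i hi
    rcases Nat.lt_or_ge n i with hn | hn
    · obtain rfl : i = n + 1 := by omega
      exact le_rfl
    · have := hmin i hn
      have := hlow i hn
      omega
  · intro t ht
    rw [height_congr_ge hag t ht]
    omega

/-! ### Unbounded paths -/

/-- The path is unbounded below. -/
def UnboundedBelow (h : ℕ → ℤ) : Prop := ∀ a : ℤ, ∃ i, h i < a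

lemma UnboundedBelow.exists_ge {h : ℕ → ℤ} (hh : UnboundedBelow h) (n : ℕ) (a : ℤ) :
    ∃ i ≥ n, h i < a := by
  obtain ⟨b, hb⟩ := ((Set.finite_lt_nat n).image h).bddBelow
  obtain ⟨i, hi⟩ := hh (min a b)
  refine ⟨i, ?_, by omega⟩
  by_contra hin
  have := hb ⟨i, not_le.1 hin, rfl⟩
  omega

lemma UnboundedBelow.of_add {h h' : ℕ → ℤ} {n : ℕ} {c : ℤ} (hh : UnboundedBelow h)
    (hc : ∀ t, n ≤ t → h' t = h t + c) : UnboundedBelow h' := by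
  intro a
  obtain ⟨i, hi, hlt⟩ := hh.exists_ge n (a - c)
  exact ⟨i, by rw [hc i hi]; omega⟩

lemma liminf_eq_bot_iff (h : ℕ → ℤ) :
    Filter.liminf (fun i => ((h i : ℝ) : EReal)) Filter.atTop = ⊥ ↔ UnboundedBelow h := by
  constructor
  · intro hl a
    by_contra! hcon
    have h1 : (((a : ℝ)) : EReal) ≤ Filter.liminf (fun i => ((h i : ℝ) : EReal)) Filter.atTop := by
      refine Filter.le_liminf_of_le (h := Filter.Eventually.of_forall fun i => ?_)
      exact_mod_cast hcon i
    rw [hl, le_bot_iff] at h1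
    exact EReal.coe_ne_bot _ h1
  · intro hh
    rw [EReal.eq_bot_iff_forall_lt]
    intro r
    obtain ⟨a, ha⟩ := exists_int_lt r
    refine lt_of_le_of_lt (b := ((a : ℝ) : EReal)) ?_ (by exact_mod_cast ha)
    refine Filter.liminf_le_of_frequently_le ?_
    rw [Filter.frequently_atTop]
    intro n
    obtain ⟨i, hi, hlt⟩ := hh.exists_ge n a
    exact ⟨i, hi, by exact_mod_cast hlt.le⟩

lemma mem_Gminus_iff (y : OneSidedShift m) : y ∈ Gminus m ↔ UnboundedBelow (height y.1) :=
  liminf_eq_bot_iff _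

lemma mem_ThetaMinus_iff (x : ℕ → ThetaLetter m) :
    x ∈ ThetaMinus m ↔ UnboundedBelow (thetaHeight x) :=
  liminf_eq_bot_iff _

lemma mem_ThetaMinus_congr {x x' : ℕ → ThetaLetter m} {n : ℕ} (h : ∀ k ≥ n, x k = x' k) :
    x ∈ ThetaMinus m ↔ x' ∈ ThetaMinus m := by
  rw [mem_ThetaMinus_iff, mem_ThetaMinus_iff]
  exact ⟨fun hx => hx.of_add (thetaHeight_congr_ge fun k hk => (h k hk).symm),
    fun hx => hx.of_add (thetaHeight_congr_ge h)⟩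

/-! ### Krieger's map and its section -/

lemma thetaHeight_kriegerMap (y : OneSidedShift m) : thetaHeight (kriegerMap m y) = height y.1 := by
  funext t
  refine Finset.sum_congr rfl fun k _ => ?_
  change ((y.1 k).forget).height = _
  cases y.1 k <;> rfl

lemma kriegerMap_mem_ThetaMinus_iff (y : OneSidedShift m) :
    kriegerMap m y ∈ ThetaMinus m ↔ y ∈ Gminus m := by
  rw [mem_ThetaMinus_iff, mem_Gminus_iff, thetaHeight_kriegerMap]

/-- The match ends at the first return to height at most `height y i`; steps have size one, so the
return is at equality. -/
lemma exists_match_of_unboundedBelow {y : ℕ → Letter m} (hy : UnboundedBelow (height y)) {i : ℕ}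
    (hi : height y (i + 1) = height y i + 1) : ∃ k, IsMatch (height y) i k := by
  classical
  have hex : ∃ k, i < k ∧ height y k ≤ height y i := by
    obtain ⟨k, hk, hlt⟩ := hy.exists_ge (i + 1) (height y i)
    exact ⟨k, by omega, by omega⟩
  obtain ⟨h1, h2⟩ := Nat.find_spec hex
  have hmin : ∀ t, i < t → t < Nat.find hex → height y i < height y t := fun t ht hlt => by
    have := Nat.find_min hex hlt
    push Not at this
    exact this ht
  generalize Nat.find hex = K at *
  obtain ⟨k, rfl⟩ : ∃ k, K = k + 1 := ⟨K - 1, by omega⟩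
  have hik : i ≠ k := by rintro rfl; omega
  refine ⟨k, by omega, ?_, fun t ht htk => hmin t ht (by omega)⟩
  have := hmin k (by omega) (by omega)
  have := (height_succ_bounds y k).1
  omega

section KriegerSection

variable [NeZero m]

open scoped Classical in
/-- The index of the letter `β` that matches position `k`, and `0` if there is none. -/
noncomputable def matchIndex (x : ℕ → ThetaLetter m) (k : ℕ) : Fin m :=
  if H : ∃ j, ∃ l, IsMatch (thetaHeight x) k l ∧ x l = .β j then H.choose else 0

lemma matchIndex_eq {x : ℕ → ThetaLetter m} {k l : ℕ} {j : Fin m}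
    (h : IsMatch (thetaHeight x) k l) (hl : x l = .β j) : matchIndex x k = j := by
  have H : ∃ j, ∃ l, IsMatch (thetaHeight x) k l ∧ x l = .β j := ⟨j, l, h, hl⟩
  rw [matchIndex, dif_pos H]
  obtain ⟨l', h', hl'⟩ := H.choose_spec
  rw [← h.right_unique h', hl] at hl'
  exact (ThetaLetter.β.inj hl').symm

/-- The section of Krieger's map on the whole full shift, as a map to sequences: every matched
`α` gets the index of its match, every other one the index `0`. -/
noncomputable def label (x : ℕ → ThetaLetter m) (k : ℕ) : Letter m :=
  match x k with
  | .α => .α (matchIndex x k)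
  | .β j => .β j

lemma forget_label (x : ℕ → ThetaLetter m) (k : ℕ) : (label x k).forget = x k := by
  rw [label]
  cases x k <;> rfl

lemma height_label (x : ℕ → ThetaLetter m) : height (label x) = thetaHeight x := by
  funext t
  refine Finset.sum_congr rfl fun k _ => ?_
  rw [← forget_label x k]
  cases label x k <;> rfl

lemma label_mem_shift (x : ℕ → ThetaLetter m) : label x ∈ OneSidedShift m := by
  rw [mem_shift_iff]
  intro i k hik
  have hi := hik.left_α
  have hk := hik.right_β
  have hi' : x i = .α := by rw [← forget_label x i, hi]; rfl
  have hk' : x k = .β (label x k).index := by rw [← forget_label x k, hk]; rfl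
  rw [height_label] at hik
  rw [← matchIndex_eq hik hk']
  simp only [label, hi']
  rfl

/-- The section of Krieger's map on the whole full shift. -/
noncomputable def kriegerSection (x : ℕ → ThetaLetter m) : OneSidedShift m :=
  ⟨label x, label_mem_shift x⟩

lemma kriegerMap_kriegerSection (x : ℕ → ThetaLetter m) : kriegerMap m (kriegerSection x) = x :=
  funext (forget_label x)

/-- Every `α` of `y` is matched, and admissibility forces its index to be that of its match, which
Krieger's map keeps. -/
lemma kriegerSection_kriegerMap {y : OneSidedShift m} (hy : y ∈ Gminus m) :
    kriegerSection (kriegerMap m y) = y := by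
  rw [mem_Gminus_iff] at hy
  refine Subtype.ext (funext fun i => ?_)
  change label (kriegerMap m y) i = y.1 i
  rcases hi : y.1 i with j | j
  · have hx : kriegerMap m y i = .α := by rw [kriegerMap, hi]; rfl
    obtain ⟨k, hik⟩ := exists_match_of_unboundedBelow hy (i := i) (by rw [height_succ, hi]; rfl)
    have hidx := (mem_shift_iff y.1).1 y.2 i k hik
    have hk : kriegerMap m y k = .β (y.1 k).index := by
      rw [kriegerMap, hik.right_β]; rfl
    rw [← thetaHeight_kriegerMap] at hik
    simp only [label, hx, matchIndex_eq hik hk, ← hidx, hi]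
    rfl
  · have hx : kriegerMap m y i = .β j := by rw [kriegerMap, hi]; rfl
    simp only [label, hx]

/-- Labels look only into the future: changing a prefix shifts the later heights by a constant,
which matching does not see. This makes the section respect tail equivalence. -/
lemma label_congr {x x' : ℕ → ThetaLetter m} {n : ℕ} (h : ∀ k ≥ n, x k = x' k) (k : ℕ)
    (hk : n ≤ k) : label x k = label x' k := by
  have hidx : matchIndex x k = matchIndex x' k := by
    have (j : Fin m) : (∃ l, IsMatch (thetaHeight x) k l ∧ x l = .β j) ↔
        ∃ l, IsMatch (thetaHeight x') k l ∧ x' l = .β j := by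
      refine exists_congr fun l => ?_
      rw [IsMatch.congr_add hk (thetaHeight_congr_ge h)]
      refine and_congr_right fun hl => ?_
      rw [h l (by have := hl.1; omega)]
    have hP : (fun j : Fin m => ∃ l, IsMatch (thetaHeight x) k l ∧ x l = .β j) =
        fun j => ∃ l, IsMatch (thetaHeight x') k l ∧ x' l = .β j :=
      funext fun j => propext (this j)
    classical
    exact congrArg (fun P : Fin m → Prop => if H : ∃ j, P j then H.choose else 0) hP
  simp only [label, h k hk, hidx]

theorem bijOn_kriegerMap : Set.BijOn (kriegerMap m) (Gminus m) (ThetaMinus m) :=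
  Set.InvOn.bijOn (f' := kriegerSection)
    ⟨fun _ hy => kriegerSection_kriegerMap hy, fun x _ => kriegerMap_kriegerSection x⟩
    (fun y hy => (kriegerMap_mem_ThetaMinus_iff y).2 hy)
    (fun x hx => (kriegerMap_mem_ThetaMinus_iff _).1 (by rwa [kriegerMap_kriegerSection]))

end KriegerSection

/-! ### Measurability -/

lemma measurable_comp_apply {L β : Type*} [MeasurableSpace L] [DiscreteMeasurableSpace L]
    [MeasurableSpace β] (f : L → β) (k : ℕ) : Measurable fun y : ℕ → L => f (y k) :=
  (Measurable.of_discrete (f := f)).comp (measurable_pi_apply k)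

lemma measurable_apply_eq {L : Type*} [MeasurableSpace L] [DiscreteMeasurableSpace L] (k : ℕ)
    (a : L) : Measurable fun y : ℕ → L => y k = a :=
  measurable_comp_apply (fun b => b = a) k

lemma measurable_height (t : ℕ) : Measurable fun y : ℕ → Letter m => height y t :=
  Finset.measurable_sum _ fun k _ => measurable_comp_apply Letter.height k

lemma measurable_thetaHeight (t : ℕ) : Measurable fun x : ℕ → ThetaLetter m => thetaHeight x t :=
  Finset.measurable_sum _ fun k _ => measurable_comp_apply ThetaLetter.height k

lemma measurable_isMatch {X : Type*} [MeasurableSpace X] {H : X → ℕ → ℤ}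
    (hH : ∀ t, Measurable fun x => H x t) (i k : ℕ) : Measurable fun x => IsMatch (H x) i k := by
  refine measurable_const.and (Measurable.and ?_ (Measurable.forall fun t =>
    measurable_const.imp (measurable_const.imp ?_)))
  · exact measurableSet_setOfPred.1 (measurableSet_eq_fun (hH _) (hH _))
  · exact measurableSet_setOfPred.1 (measurableSet_lt (hH _) (hH _))

lemma measurableSet_shift : MeasurableSet (OneSidedShift m) := by
  have : OneSidedShift m =
      {y | ∀ i k, IsMatch (height y) i k → (y i).index = (y k).index} :=
    Set.ext fun y => mem_shift_iff y
  rw [this, measurableSet_setOfPred]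
  refine Measurable.forall fun i => Measurable.forall fun k =>
    (measurable_isMatch measurable_height i k).imp (measurableSet_setOfPred.1 ?_)
  exact measurableSet_eq_fun (measurable_comp_apply Letter.index i) (measurable_comp_apply Letter.index k)

instance : StandardBorelSpace (OneSidedShift m) := measurableSet_shift.standardBorel

lemma measurable_unboundedBelow {X : Type*} [MeasurableSpace X] {H : X → ℕ → ℤ}
    (hH : ∀ t, Measurable fun x => H x t) : Measurable fun x => UnboundedBelow (H x) :=
  Measurable.forall fun _ => Measurable.exists fun i =>
    measurableSet_setOfPred.1 (measurableSet_lt (hH i) measurable_const)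

lemma measurableSet_Gminus : MeasurableSet (Gminus m) := by
  have : Gminus m = {y | UnboundedBelow (height y.1)} := Set.ext mem_Gminus_iff
  rw [this, measurableSet_setOfPred]
  exact measurable_unboundedBelow fun t => (measurable_height t).comp measurable_subtype_coe

lemma measurableSet_ThetaMinus : MeasurableSet (ThetaMinus m) := by
  have : ThetaMinus m = {x | UnboundedBelow (thetaHeight x)} := Set.ext mem_ThetaMinus_iff
  rw [this, measurableSet_setOfPred]
  exact measurable_unboundedBelow measurable_thetaHeight

lemma measurable_splice {L : Type*} [MeasurableSpace L] (n : ℕ) (w : ℕ → L) :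
    Measurable (splice n w) := by
  refine measurable_pi_lambda _ fun k => ?_
  by_cases hk : k < n
  · simp only [splice, if_pos hk]; exact measurable_const
  · simp only [splice, if_neg hk]; exact measurable_pi_apply k

lemma measurable_kriegerMap : Measurable (kriegerMap m) :=
  measurable_pi_lambda _ fun k =>
    (measurable_comp_apply Letter.forget k).comp measurable_subtype_coe

lemma measurableSet_cylinder {L : Type*} [MeasurableSpace L] [MeasurableSingletonClass L]
    (w : ℕ → L) (n : ℕ) : MeasurableSet (PiNat.cylinder w n) := by
  have : PiNat.cylinder w n = ⋂ i, ⋂ _ : i < n, (fun x : ℕ → L => x i) ⁻¹' {w i} := by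
    ext x; simp [PiNat.cylinder]
  rw [this]
  exact MeasurableSet.iInter fun i => MeasurableSet.iInter fun _ =>
    measurable_pi_apply i (measurableSet_singleton _)

lemma measurable_label [NeZero m] : Measurable (label : (ℕ → ThetaLetter m) → ℕ → Letter m) := by
  refine measurable_pi_lambda _ fun k => measurable_to_countable' fun a => ?_
  have hE (j : Fin m) : Measurable fun x : ℕ → ThetaLetter m =>
      ∃ l, IsMatch (thetaHeight x) k l ∧ x l = .β j :=
    Measurable.exists fun l => (measurable_isMatch measurable_thetaHeight k l).and
      (measurable_apply_eq l _)
  rcases a with j | j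
  -- The last alternative accounts for the default index `0` of an unmatched `α`.
  · have : (fun x : ℕ → ThetaLetter m => label x k) ⁻¹' {.α j} =
        {x | x k = .α ∧ ((∃ l, IsMatch (thetaHeight x) k l ∧ x l = .β j) ∨
          (¬ ∃ j', ∃ l, IsMatch (thetaHeight x) k l ∧ x l = .β j') ∧ j = 0)} := by
      ext x
      simp only [Set.mem_preimage, Set.mem_singleton_iff, Set.mem_ofPred_eq]
      rcases hxk : x k with _ | j''
      · simp only [label, hxk, Letter.α.injEq, true_and]
        by_cases H : ∃ j', ∃ l, IsMatch (thetaHeight x) k l ∧ x l = .β j'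
        · obtain ⟨j', l, hl, hl'⟩ := H
          rw [matchIndex_eq hl hl']
          constructor
          · rintro rfl; exact Or.inl ⟨l, hl, hl'⟩
          · rintro (⟨l2, hl2, hl2'⟩ | ⟨hn, -⟩)
            · rw [← hl.right_unique hl2, hl'] at hl2'
              exact ThetaLetter.β.inj hl2'
            · exact absurd ⟨j', l, hl, hl'⟩ hn
        · rw [matchIndex, dif_neg H]
          constructor
          · rintro rfl; exact Or.inr ⟨H, rfl⟩
          · rintro (h | ⟨-, h⟩)
            · exact absurd ⟨j, h⟩ H
            · exact h.symm
      · simp [label, hxk]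
    rw [this, measurableSet_setOfPred]
    exact (measurable_apply_eq k _).and ((hE j).or ((Measurable.exists hE).not.and measurable_const))
  · have : (fun x : ℕ → ThetaLetter m => label x k) ⁻¹' {.β j} = {x | x k = .β j} := by
      ext x
      simp only [Set.mem_preimage, Set.mem_singleton_iff, Set.mem_ofPred_eq]
      rcases hxk : x k with _ | j'' <;> simp [label, hxk]
    rw [this, measurableSet_setOfPred]
    exact measurable_apply_eq k _

lemma measurable_kriegerSection [NeZero m] :
    Measurable (kriegerSection : (ℕ → ThetaLetter m) → OneSidedShift m) :=
  measurable_label.subtype_mk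

/-! ### Holonomies and finiteness -/

/-- The form in which invariance is used: `f` is defined on all sequences, so that its measurability
is easy, and only on `A` must it stay in the shift and in the tail class. -/
lemma IsInvariantMeasure.measure_le {ν : Measure (OneSidedShift m)}
    (hν : IsInvariantMeasure (TailRel m) ν) {A B : Set (OneSidedShift m)} (hA : MeasurableSet A)
    {f : (ℕ → Letter m) → ℕ → Letter m} (hf : Measurable f)
    (hmaps : ∀ y ∈ A, ∃ h : f y.1 ∈ OneSidedShift m, TailRel m y ⟨f y.1, h⟩ ∧ ⟨f y.1, h⟩ ∈ B)
    (hinj : ∀ y ∈ A, ∀ z ∈ A, f y.1 = f z.1 → y = z) : ν A ≤ ν B := by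
  let g : A → OneSidedShift m := fun y => ⟨f y.1.1, (hmaps y.1 y.2).choose⟩
  have hg : IsHolonomy (TailRel m) A g :=
    { measurableSet := hA
      measurable :=
        (hf.comp (measurable_subtype_coe.comp measurable_subtype_coe)).subtype_mk
      injective := fun y z h =>
        Subtype.ext (hinj y.1 y.2 z.1 z.2 (congrArg Subtype.val h))
      rel := fun y => (hmaps y.1 y.2).choose_spec.1 }
  rw [hν A g hg]
  refine measure_mono ?_
  rintro _ ⟨y, rfl⟩
  exact (hmaps y.1 y.2).choose_spec.2

lemma exists_cylinder_subset {U : Set (OneSidedShift m)} (hU : IsOpen U) {y : OneSidedShift m}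
    (hy : y ∈ U) : ∃ n, ∀ z : OneSidedShift m, (∀ k < n, z.1 k = y.1 k) → z ∈ U := by
  obtain ⟨V, hV, rfl⟩ := isOpen_induced_iff.1 hU
  obtain ⟨_, ⟨x, n, rfl⟩, hyx, hsub⟩ :=
    (PiNat.isTopologicalBasis_cylinders fun _ : ℕ => Letter m).exists_subset_of_mem_open hy hV
  exact ⟨n, fun z hz => hsub fun k hk => (hz k hk).trans (hyx k hk)⟩

/-- Topologically `σ`-finite invariant measures are finite. -/
theorem isFiniteMeasure_of_isTopologicallySigmaFinite {ν : Measure (OneSidedShift m)}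
    (hν : IsInvariantMeasure (TailRel m) ν) (hs : IsTopologicallySigmaFinite ν) :
    IsFiniteMeasure ν := by
  obtain ⟨N, hN, U, hU, hcov⟩ := hs
  by_cases hne : ∃ n, (U n).Nonempty
  swap
  -- If all the open sets are empty, the whole space is null.
  · push Not at hne
    have hNu : N = Set.univ := by
      rw [← Set.compl_empty_iff]
      simpa [hne] using hcov
    rw [hNu] at hN
    exact ⟨by simp [hN]⟩
  obtain ⟨n, y, hy⟩ := hne
  obtain ⟨k, hk⟩ := exists_cylinder_subset (hU n).1 hy
  obtain ⟨w, hw, hwy, K, hK, hmin⟩ := exists_closing y.2 k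
  let C (v : Fin K → Letter m) : Set (OneSidedShift m) := {z | ∀ i : Fin K, z.1 i = v i}
  have hC (v) : MeasurableSet (C v) := by
    have : C v = ⋂ i : Fin K, {z | z.1 i = v i} := by ext; simp [C]
    rw [this]
    exact MeasurableSet.iInter fun i =>
      measurable_subtype_coe (measurableSet_setOfPred.2 (measurable_apply_eq (i : ℕ) (v i)))
  -- Replacing the prefix `v` by the closing prefix of `w` is injective on `C v` and lands in the
  -- cylinder inside `U n`.
  have hle (v) : ν (C v) ≤ ν (U n) := by
    refine hν.measure_le (hC v) (measurable_splice K w) ?_ ?_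
    · intro z _
      refine ⟨splice_mem_shift z.2 hw hmin, ⟨K, fun i hi => (splice_of_le w z.1 hi.le).symm⟩, ?_⟩
      refine hk _ fun i hi => ?_
      rw [← hwy i hi]
      exact splice_of_lt w z.1 (hi.trans_le hK)
    · intro y hy z hz h
      refine Subtype.ext (funext fun i => ?_)
      rcases Nat.lt_or_ge i K with hi | hi
      · exact (hy ⟨i, hi⟩).trans (hz ⟨i, hi⟩).symm
      · rw [← splice_of_le w y.1 hi, h, splice_of_le w z.1 hi]
  refine ⟨?_⟩
  have huniv : (Set.univ : Set (OneSidedShift m)) = ⋃ v, C v :=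
    (Set.eq_univ_of_forall fun z => Set.mem_iUnion.2
      (show ∃ v, z ∈ C v from ⟨fun i => z.1 i, fun _ => rfl⟩)).symm
  rw [huniv]
  refine (measure_iUnion_le _).trans_lt ?_
  rw [tsum_fintype]
  exact ENNReal.sum_lt_top.2 fun v _ => (hle v).trans_lt (hU n).2

/-! ### The complement of `G₋` is null -/

lemma measure_eq_zero_of_le_disjoint {X : Type*} [MeasurableSpace X] {ν : Measure X}
    [IsFiniteMeasure ν] {D : ℕ → Set X} (hD : ∀ k, MeasurableSet (D k))
    (hdisj : Pairwise (Function.onFun Disjoint D)) (hle : ∀ k, ν (D 0) ≤ ν (D k)) :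
    ν (D 0) = 0 := by
  by_contra h0
  have h1 : ∑' _ : ℕ, ν (D 0) = ⊤ := ENNReal.tsum_const_eq_top_of_ne_zero h0
  have h2 : ∑' _ : ℕ, ν (D 0) ≤ ν (⋃ k, D k) := by
    rw [measure_iUnion hdisj hD]
    exact ENNReal.tsum_le_tsum hle
  rw [h1, top_le_iff] at h2
  exact measure_ne_top ν _ h2

/-- The `β` with the index of the given letter. -/
def Letter.lower : Letter m → Letter m
  | .α j => .β j
  | .β j => .β j

open scoped Classical in
/-- Lower the letters at the positions selected by `S`. -/
noncomputable def lowerAt (S : ℕ → (ℕ → Letter m) → Prop) (y : ℕ → Letter m) (k : ℕ) : Letter m :=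
  if S k y then (y k).lower else y k

lemma measurable_lowerAt {S : ℕ → (ℕ → Letter m) → Prop} (hS : ∀ k, Measurable (S k)) :
    Measurable (lowerAt S) := by
  classical
  refine measurable_pi_lambda _ fun k => ?_
  exact Measurable.ite (measurableSet_setOfPred.2 (hS k))
    (measurable_comp_apply Letter.lower k) (measurable_pi_apply k)

/-- Lowering a letter `α` that leaves the minimal height `a`, at a position selected by `S`,
does not increase the measure of a set of sequences. -/
lemma IsInvariantMeasure.measure_le_of_lower {ν : Measure (OneSidedShift m)}
    (hν : IsInvariantMeasure (TailRel m) ν) {A B : Set (OneSidedShift m)} (hA : MeasurableSet A)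
    (a : ℤ) {S : ℕ → (ℕ → Letter m) → Prop} (hS : ∀ k, Measurable (S k))
    (hmin : ∀ y ∈ A, ∀ i, a ≤ height y.1 i)
    (hsel : ∀ y ∈ A, ∃ n, height y.1 n = a ∧ (∀ k, S k y.1 ↔ k = n) ∧
      ∀ z : OneSidedShift m, (∀ t ≤ n, height z.1 t = height y.1 t) →
        (∀ t, n < t → height z.1 t = height y.1 t - 2) → z ∈ B) : ν A ≤ ν B := by
  have key : ∀ y ∈ A, ∃ n, height y.1 n = a ∧ (∃ j, y.1 n = .α j ∧ lowerAt S y.1 n = .β j) ∧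
      (∀ k, k ≠ n → lowerAt S y.1 k = y.1 k) ∧
      ∀ z : OneSidedShift m, (∀ t ≤ n, height z.1 t = height y.1 t) →
        (∀ t, n < t → height z.1 t = height y.1 t - 2) → z ∈ B := by
    intro y hy
    obtain ⟨n, hn, hSn, hB⟩ := hsel y hy
    refine ⟨n, hn, ?_, fun k hk => if_neg fun h => hk ((hSn k).1 h), hB⟩
    have hup := hmin y hy (n + 1)
    rw [height_succ] at hup
    rcases hyn : y.1 n with j | j
    · exact ⟨j, rfl, by rw [lowerAt, if_pos ((hSn n).2 rfl), hyn]; rfl⟩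
    · rw [hyn, height_β] at hup; omega
  have key' : ∀ y ∈ A, ∀ n j, height y.1 n = a → y.1 n = .α j → lowerAt S y.1 n = .β j →
      (∀ k, k ≠ n → lowerAt S y.1 k = y.1 k) → lowerAt S y.1 ∈ OneSidedShift m ∧
        (∀ t ≤ n, height (lowerAt S y.1) t = height y.1 t) ∧
        ∀ t, n < t → height (lowerAt S y.1) t = height y.1 t - 2 :=
    fun y hy n j hn hα hβ hne => flip_mem_shift y.2 (fun i _ => hn ▸ hmin y hy i) hα hβ hne
  refine hν.measure_le hA (measurable_lowerAt hS) ?_ ?_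
  · intro y hy
    obtain ⟨n, hn, ⟨j, hα, hβ⟩, hne, hB⟩ := key y hy
    obtain ⟨h1, h2, h3⟩ := key' y hy n j hn hα hβ hne
    exact ⟨h1, ⟨n, fun k hk => (hne k (by omega)).symm⟩, hB _ h2 h3⟩
  · intro y hy z hz hyz
    obtain ⟨n, hn, ⟨j, hα, hβ⟩, hne, -⟩ := key y hy
    obtain ⟨-, h2, h3⟩ := key' y hy n j hn hα hβ hne
    obtain ⟨n', hn', ⟨j', hα', hβ'⟩, hne', -⟩ := key z hz
    obtain ⟨-, h2', h3'⟩ := key' z hz n' j' hn' hα' hβ' hne'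
    have hs := h3 (n + 1) (by omega)
    have hs' := h3' (n' + 1) (by omega)
    have hb := (height_succ_bounds y.1 n).2
    have hb' := (height_succ_bounds z.1 n').2
    rw [← hyz] at h2' hs'
    -- The place of the change can be recovered: `n + 1` is the first time the lowered path is below
    -- `a`. The index survives in the new `β`.
    obtain rfl : n = n' := by
      by_contra hnn
      rcases Nat.lt_or_gt_of_ne hnn with hlt | hlt
      · have := h2' (n + 1) (by omega)
        have := hmin z hz (n + 1)
        omega
      · have := h2 (n' + 1) (by omega)
        have := hmin y hy (n' + 1)
        omega
    refine Subtype.ext (funext fun k => ?_)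
    by_cases hk : k = n
    · subst hk
      rw [← hyz, hβ] at hβ'
      rw [hα, hα', Letter.β.inj hβ']
    · rw [← hne k hk, hyz, hne' k hk]

/-- The sequences with least height `a`. -/
def leastHeight (m : ℕ) (a : ℤ) : Set (OneSidedShift m) :=
  {y | (∀ i, a ≤ height y.1 i) ∧ ∃ i, height y.1 i = a}

/-- The sequences that reach their least height `a` infinitely often. -/
def leastHeightFrequently (m : ℕ) (a : ℤ) : Set (OneSidedShift m) :=
  {y | (∀ i, a ≤ height y.1 i) ∧ ∀ n, ∃ i ≥ n, height y.1 i = a}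

lemma leastHeightFrequently_subset (a : ℤ) : leastHeightFrequently m a ⊆ leastHeight m a :=
  fun _ hy => ⟨hy.1, (hy.2 0).imp fun _ h => h.2⟩

lemma disjoint_leastHeight {a b : ℤ} (hab : a ≠ b) :
    Disjoint (leastHeight m a) (leastHeight m b) := by
  rw [Set.disjoint_left]
  rintro y ⟨h1, i, hi⟩ ⟨h1', i', hi'⟩
  have := h1 i'
  have := h1' i
  omega

lemma measurable_height_le (a : ℤ) (i : ℕ) :
    Measurable fun y : ℕ → Letter m => a ≤ height y i :=
  measurableSet_setOfPred.1 (measurableSet_le measurable_const (measurable_height i))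

lemma measurable_height_eq (a : ℤ) (i : ℕ) :
    Measurable fun y : ℕ → Letter m => height y i = a :=
  measurableSet_setOfPred.1 (measurableSet_eq_fun (measurable_height i) measurable_const)

lemma measurableSet_leastHeight (a : ℤ) : MeasurableSet (leastHeight m a) :=
  measurable_subtype_coe (measurableSet_setOfPred.2
    ((Measurable.forall (measurable_height_le a)).and
      (Measurable.exists (measurable_height_eq a))))

lemma measurableSet_leastHeightFrequently (a : ℤ) : MeasurableSet (leastHeightFrequently m a) :=
  measurable_subtype_coe (measurableSet_setOfPred.2
    ((Measurable.forall (measurable_height_le a)).and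
      (Measurable.forall fun _ => Measurable.exists fun i =>
        measurable_const.and (measurable_height_eq a i))))

/-- The letter at the first visit to `a` is lowered. Later visits to `a` become visits to `a - 2`,
and infinitely many remain. -/
lemma measure_leastHeightFrequently_le {ν : Measure (OneSidedShift m)}
    (hν : IsInvariantMeasure (TailRel m) ν) (a : ℤ) :
    ν (leastHeightFrequently m a) ≤ ν (leastHeightFrequently m (a - 2)) := by
  classical
  refine hν.measure_le_of_lower (measurableSet_leastHeightFrequently a) a
    (S := fun k y => height y k = a ∧ ∀ i < k, ¬ height y i = a)
    (fun k => (measurable_height_eq a k).and (Measurable.forall fun i =>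
      measurable_const.imp (measurable_height_eq a i).not)) (fun y hy => hy.1) ?_
  intro y hy
  have hex : ∃ i, height y.1 i = a := (leastHeightFrequently_subset a hy).2
  refine ⟨Nat.find hex, Nat.find_spec hex, fun k => ?_, fun z h1 h2 => ⟨fun i => ?_, fun n => ?_⟩⟩
  · rw [eq_comm (a := k), Nat.find_eq_iff]
  · have := hy.1 i
    rcases Nat.lt_or_ge (Nat.find hex) i with hi | hi
    · rw [h2 i hi]; omega
    · rw [h1 i hi]; omega
  · obtain ⟨i, hi, hia⟩ := hy.2 (max n (Nat.find hex + 1))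
    exact ⟨i, by omega, by rw [h2 i (by omega)]; omega⟩

lemma measure_leastHeightFrequently {ν : Measure (OneSidedShift m)} [IsFiniteMeasure ν]
    (hν : IsInvariantMeasure (TailRel m) ν) (a : ℤ) : ν (leastHeightFrequently m a) = 0 := by
  have := measure_eq_zero_of_le_disjoint (ν := ν)
    (D := fun k : ℕ => leastHeightFrequently m (a - 2 * k))
    (fun k => measurableSet_leastHeightFrequently _)
    (fun i k hik => (disjoint_leastHeight (by omega)).mono (leastHeightFrequently_subset _)
      (leastHeightFrequently_subset _)) ?_
  · simpa using this
  · intro k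
    induction k with
    | zero => exact le_rfl
    | succ k ih =>
      refine ih.trans ((measure_leastHeightFrequently_le hν _).trans_eq ?_)
      congr 2
      push_cast
      ring

/-- Once infinitely many visits are excluded there is a last visit to `a`, and its letter is
lowered. The path stays at `a + 1` or higher afterwards, so the new minimum is `a - 1`, attained one
step after the visit. -/
lemma measure_leastHeight_le {ν : Measure (OneSidedShift m)} [IsFiniteMeasure ν]
    (hν : IsInvariantMeasure (TailRel m) ν) (a : ℤ) :
    ν (leastHeight m a) ≤ ν (leastHeight m (a - 1)) := by
  classical
  have hdiff : ν (leastHeight m a) = ν (leastHeight m a \ leastHeightFrequently m a) :=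
    (measure_sdiff_null (measure_leastHeightFrequently hν a)).symm
  rw [hdiff]
  refine hν.measure_le_of_lower
    ((measurableSet_leastHeight a).diff (measurableSet_leastHeightFrequently a)) a
    (S := fun k y => height y k = a ∧ ∀ i, k < i → ¬ height y i = a)
    (fun k => (measurable_height_eq a k).and (Measurable.forall fun i =>
      measurable_const.imp (measurable_height_eq a i).not)) (fun y hy => hy.1.1) ?_
  intro y hy
  have hmin := hy.1.1
  obtain ⟨i₀, hi₀⟩ := hy.1.2
  obtain ⟨N, hN⟩ : ∃ N, ∀ i ≥ N, height y.1 i ≠ a := by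
    by_contra! h
    exact hy.2 ⟨hmin, h⟩
  have hb : i₀ ≤ N := by
    by_contra! h
    exact hN i₀ h.le hi₀
  obtain ⟨hn, hlast⟩ : height y.1 (Nat.findGreatest (fun i => height y.1 i = a) N) = a ∧
      ∀ i, Nat.findGreatest (fun i => height y.1 i = a) N < i → ¬ height y.1 i = a := by
    refine ⟨Nat.findGreatest_spec (P := fun i => height y.1 i = a) hb hi₀, fun i hi => ?_⟩
    rcases Nat.lt_or_ge N i with h | h
    · exact hN i h.le
    · exact Nat.findGreatest_is_greatest hi h
  generalize Nat.findGreatest (fun i => height y.1 i = a) N = n at hn hlast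
  refine ⟨n, hn, fun k => ⟨fun hk => ?_, ?_⟩, fun z h1 h2 => ⟨fun i => ?_, n + 1, ?_⟩⟩
  · by_contra hne
    rcases Nat.lt_or_gt_of_ne hne with h | h
    · exact hk.2 n h hn
    · exact hlast k h hk.1
  · rintro rfl
    exact ⟨hn, hlast⟩
  · have := hmin i
    rcases Nat.lt_or_ge n i with hi | hi
    · have := hlast i hi
      rw [h2 i hi]; omega
    · rw [h1 i hi]; omega
  · have := hlast (n + 1) (by omega)
    have := hmin (n + 1)
    have := (height_succ_bounds y.1 n).2
    rw [h2 (n + 1) (by omega)]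
    omega

lemma measure_leastHeight {ν : Measure (OneSidedShift m)} [IsFiniteMeasure ν]
    (hν : IsInvariantMeasure (TailRel m) ν) (a : ℤ) : ν (leastHeight m a) = 0 := by
  have := measure_eq_zero_of_le_disjoint (ν := ν) (D := fun k : ℕ => leastHeight m (a - k))
    (fun k => measurableSet_leastHeight _) (fun i k hik => disjoint_leastHeight (by omega)) ?_
  · simpa using this
  · intro k
    induction k with
    | zero => exact le_rfl
    | succ k ih =>
      refine ih.trans ((measure_leastHeight_le hν _).trans_eq ?_)
      congr 2
      push_cast
      ring

/-- Finite invariant measures live on `G₋`. -/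
theorem measure_compl_Gminus {ν : Measure (OneSidedShift m)} [IsFiniteMeasure ν]
    (hν : IsInvariantMeasure (TailRel m) ν) : ν (Gminus m)ᶜ = 0 := by
  refine measure_mono_null (t := ⋃ a : ℤ, leastHeight m a) ?_
    (measure_iUnion_null fun a => measure_leastHeight hν a)
  intro y hy
  rw [Set.mem_compl_iff, mem_Gminus_iff, UnboundedBelow] at hy
  push Not at hy
  obtain ⟨b, hb⟩ := hy
  obtain ⟨a, ⟨i, hi⟩, ha⟩ := Int.exists_least_of_bdd (P := fun a => ∃ i, height y.1 i = a)
    ⟨b, by rintro _ ⟨i, rfl⟩; exact hb i⟩ ⟨_, 0, rfl⟩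
  exact Set.mem_iUnion.2 ⟨a, fun k => ha _ ⟨k, rfl⟩, i, hi⟩

/-! ### Cylinders and the Bernoulli measure -/

lemma cylinder_inter_cylinder {L : Type*} {w v x : ℕ → L} {k n : ℕ}
    (hw : ∀ i < k, x i = w i) (hv : ∀ i < n, x i = v i) :
    PiNat.cylinder w k ∩ PiNat.cylinder v n = PiNat.cylinder x (max k n) := by
  ext z
  simp only [Set.mem_inter_iff, PiNat.mem_cylinder_iff, lt_max_iff]
  constructor
  · rintro ⟨h1, h2⟩ i (hi | hi)
    · rw [h1 i hi, hw i hi]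
    · rw [h2 i hi, hv i hi]
  · intro h
    exact ⟨fun i hi => (h i (Or.inl hi)).trans (hw i hi),
      fun i hi => (h i (Or.inr hi)).trans (hv i hi)⟩

/-- Finite measures on a sequence space over a countable alphabet are determined by their values
on cylinders. -/
lemma measure_ext_of_cylinder {L : Type*} [MeasurableSpace L] [DiscreteMeasurableSpace L]
    [Countable L] [Nonempty L] {μ ν : Measure (ℕ → L)} [IsFiniteMeasure μ]
    (h : ∀ w n, μ (PiNat.cylinder w n) = ν (PiNat.cylinder w n)) : μ = ν := by
  let _ : TopologicalSpace L := ⊥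
  have : DiscreteTopology L := ⟨rfl⟩
  refine ext_of_generate_finite {s | ∃ (x : ℕ → L) (n : ℕ), s = PiNat.cylinder x n} ?_ ?_ ?_ ?_
  · rw [BorelSpace.measurable_eq (α := ℕ → L)]
    exact (PiNat.isTopologicalBasis_cylinders fun _ : ℕ => L).borel_eq_generateFrom
  · rintro _ ⟨w, k, rfl⟩ _ ⟨v, n, rfl⟩ ⟨x, hxw, hxv⟩
    exact ⟨x, max k n, cylinder_inter_cylinder hxw hxv⟩
  · rintro _ ⟨w, n, rfl⟩
    exact h w n
  · obtain ⟨w⟩ : Nonempty (ℕ → L) := inferInstance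
    have := h w 0
    rwa [PiNat.cylinder_zero] at this

/-- A measure that gives the same mass to all cylinders of the same length. -/
lemma measure_cylinder_of_uniform {L : Type*} [MeasurableSpace L] [DiscreteMeasurableSpace L]
    [Fintype L] [Nonempty L] {μ : Measure (ℕ → L)}
    (h : ∀ w w' n, μ (PiNat.cylinder w n) = μ (PiNat.cylinder w' n)) (w : ℕ → L) (n : ℕ) :
    μ (PiNat.cylinder w n) = μ Set.univ * ((Fintype.card L : ℝ≥0∞)⁻¹) ^ n := by
  induction n generalizing w with
  | zero => simp
  | succ n ih =>
    have hsum : μ (PiNat.cylinder w n) = Fintype.card L * μ (PiNat.cylinder w (n + 1)) := by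
      rw [← PiNat.iUnion_cylinder_update w n, measure_iUnion]
      · simp only [h _ w, tsum_fintype, Finset.sum_const, Finset.card_univ, nsmul_eq_mul]
      · intro a b hab
        rw [Function.onFun, Set.disjoint_left]
        intro x hx hx'
        have h1 := hx n (by omega)
        have h2 := hx' n (by omega)
        simp only [Function.update_self] at h1 h2
        exact hab (h1.symm.trans h2)
      · exact fun a => measurableSet_cylinder _ _
    rw [pow_succ, ← mul_assoc, ← ih w, hsum, mul_comm, ← mul_assoc, ENNReal.inv_mul_cancel
      (by simp) (by simp), one_mul]

instance : IsProbabilityMeasure (bernoulli m) := by unfold bernoulli; infer_instance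

lemma bernoulli_cylinder (w : ℕ → ThetaLetter m) (n : ℕ) :
    bernoulli m (PiNat.cylinder w n) = ((Fintype.card (ThetaLetter m) : ℝ≥0∞)⁻¹) ^ n := by
  rw [PiNat.cylinder_eq_pi, bernoulli, Measure.infinitePi_pi _ fun _ _ => measurableSet_singleton _]
  have h (a : ThetaLetter m) : (PMF.uniformOfFintype (ThetaLetter m)).toMeasure {a} =
      (Fintype.card (ThetaLetter m) : ℝ≥0∞)⁻¹ := by
    rw [PMF.toMeasure_apply_singleton _ _ (measurableSet_singleton a), PMF.uniformOfFintype_apply]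
  simp only [h, Finset.prod_const, Finset.card_range]

/-- Exchanging prefixes transports the Bernoulli measure. -/
lemma bernoulli_restrict_cylinder (v v' : ℕ → ThetaLetter m) (n : ℕ) :
    (bernoulli m).restrict (PiNat.cylinder v' n) =
      ((bernoulli m).restrict (PiNat.cylinder v n)).map (splice n v') := by
  refine measure_ext_of_cylinder fun w k => ?_
  rw [Measure.map_apply (measurable_splice n v') (measurableSet_cylinder w k),
    Measure.restrict_apply (measurableSet_cylinder w k),
    Measure.restrict_apply (measurable_splice n v' (measurableSet_cylinder w k))]
  -- Two cylinders are nested or disjoint. In the first case both sides are the mass of a cylinder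
  -- of length `max k n`.
  by_cases h : ∀ i < min k n, v' i = w i
  · rw [cylinder_inter_cylinder (x := splice n v' w), bernoulli_cylinder]
    · have : splice n v' ⁻¹' PiNat.cylinder w k ∩ PiNat.cylinder v n =
          PiNat.cylinder (splice n v w) (max k n) := by
        ext z
        simp only [Set.mem_inter_iff, Set.mem_preimage, PiNat.mem_cylinder_iff, splice, lt_max_iff]
        constructor
        · rintro ⟨h1, h2⟩ i hi
          by_cases hin : i < n
          · rw [if_pos hin]; exact h2 i hin
          · have := h1 i (by omega)
            rwa [if_neg hin] at this ⊢
        · refine fun hz => ⟨fun i hi => ?_, fun i hi => ?_⟩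
          · by_cases hin : i < n
            · rw [if_pos hin]; exact h i (lt_min hi hin)
            · have := hz i (Or.inl hi)
              rwa [if_neg hin] at this ⊢
          · have := hz i (Or.inr hi)
            rwa [if_pos hi] at this
      rw [this, bernoulli_cylinder]
    · intro i hi
      by_cases hin : i < n
      · rw [splice_of_lt _ _ hin]; exact h i (lt_min hi hin)
      · exact splice_of_le _ _ (not_lt.1 hin)
    · exact fun i hi => splice_of_lt _ _ hi
  · push Not at h
    obtain ⟨i, hi, hne⟩ := h
    rw [lt_min_iff] at hi
    have h1 : PiNat.cylinder w k ∩ PiNat.cylinder v' n = ∅ :=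
      Set.eq_empty_of_forall_notMem fun z hz => hne (by rw [← hz.1 i hi.1, ← hz.2 i hi.2])
    have h2 : splice n v' ⁻¹' PiNat.cylinder w k ∩ PiNat.cylinder v n = ∅ :=
      Set.eq_empty_of_forall_notMem fun z hz => hne (by
        rw [← hz.1 i hi.1, splice_of_lt _ _ hi.2])
    rw [h1, h2, measure_empty]

open ProbabilityTheory in
/-- The heights are almost surely unbounded below, since the drift is negative. -/
theorem bernoulli_compl_ThetaMinus (hm : 2 ≤ m) : bernoulli m (ThetaMinus m)ᶜ = 0 := by
  let f : ThetaLetter m → ℝ := fun a => (a.height : ℝ)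
  let P : Measure (ThetaLetter m) := (PMF.uniformOfFintype (ThetaLetter m)).toMeasure
  let X : ℕ → (ℕ → ThetaLetter m) → ℝ := fun i x => f (x i)
  have hf : Measurable f := Measurable.of_discrete
  have hX (i : ℕ) : Measurable (X i) := measurable_comp_apply f i
  have hmap (i : ℕ) : (bernoulli m).map (fun x => x i) = P := Measure.infinitePi_map_eval _ i
  have hint : Integrable (X 0) (bernoulli m) := by
    refine Integrable.of_bound (hX 0).aestronglyMeasurable 1 (Filter.Eventually.of_forall fun x => ?_)
    change ‖((x 0).height : ℝ)‖ ≤ 1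
    cases x 0 <;> simp [ThetaLetter.height]
  have hindep : iIndepFun X (bernoulli m) :=
    iIndepFun_infinitePi (P := fun _ : ℕ => P) (X := fun _ => f) fun _ => hf
  have hident (i : ℕ) : IdentDistrib (X i) (X 0) (bernoulli m) (bernoulli m) := by
    refine IdentDistrib.comp (u := f) (f := fun x : ℕ → ThetaLetter m => x i)
      (g := fun x : ℕ → ThetaLetter m => x 0) ⟨?_, ?_, ?_⟩ hf
    · exact (measurable_pi_apply i).aemeasurable
    · exact (measurable_pi_apply 0).aemeasurable
    · rw [hmap, hmap]
  -- The mean is `(1 - m) / (m + 1)`.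
  have hmean : ∫ x, X 0 x ∂(bernoulli m) < 0 := by
    have h1 : ∫ x, X 0 x ∂(bernoulli m) = ∫ a, f a ∂P := by
      rw [← hmap 0, integral_map (measurable_pi_apply 0).aemeasurable hf.aestronglyMeasurable]
    rw [h1, PMF.integral_eq_sum, ← (thetaLetterEquiv m).sum_comp, Fintype.sum_option]
    simp only [PMF.uniformOfFintype_apply, thetaLetterEquiv, Equiv.coe_fn_mk, f, ThetaLetter.height]
    have hc : 0 < ((Fintype.card (ThetaLetter m) : ℝ≥0∞)⁻¹).toReal :=
      ENNReal.toReal_pos (by simp) (by simp)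
    have hm' : (2 : ℝ) ≤ m := by exact_mod_cast hm
    simp only [smul_eq_mul, Finset.sum_const, Finset.card_univ, Fintype.card_fin, nsmul_eq_mul]
    push_cast
    nlinarith
  have hlaw := strong_law_ae_real X hint (fun i j hij => hindep.indepFun hij) hident
  rw [← compl_compl (ThetaMinus m), compl_compl, ← mem_ae_iff]
  filter_upwards [hlaw] with x hx
  rw [mem_ThetaMinus_iff]
  intro a
  generalize ∫ x, X 0 x ∂(bernoulli m) = c at hx hmean
  -- Averages that are eventually below `c / 2 < 0` push the heights to `-∞`.
  have h1 := hx.eventually_lt_const (show c < c / 2 by linarith)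
  have h2 : Filter.Tendsto (fun n : ℕ => (n : ℝ) * (c / 2)) Filter.atTop Filter.atBot :=
    tendsto_natCast_atTop_atTop.atTop_mul_const_of_neg (by linarith)
  obtain ⟨n, hn1, hn2, hn3⟩ := (h1.and ((h2.eventually_lt_atBot (a : ℝ)).and
    (Filter.eventually_gt_atTop 0))).exists
  refine ⟨n, ?_⟩
  have hn : (0 : ℝ) < n := by exact_mod_cast hn3
  rw [div_lt_iff₀ hn] at hn1
  have hS : ((thetaHeight x n : ℤ) : ℝ) = ∑ i ∈ Finset.range n, X i x := by
    simp [thetaHeight, X, f]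
  have : ((thetaHeight x n : ℤ) : ℝ) < a := by rw [hS]; linarith
  exact_mod_cast this

/-! ### The invariant measure -/

lemma kriegerMap_splice {n : ℕ} {v : ℕ → Letter m} {y z : OneSidedShift m}
    (h : z.1 = splice n v y.1) :
    kriegerMap m z = splice n (fun k => (v k).forget) (kriegerMap m y) := by
  funext k
  rw [kriegerMap, h]
  by_cases hk : k < n
  · rw [splice_of_lt _ _ hk, splice_of_lt _ _ hk]
  · rw [splice_of_le _ _ (not_lt.1 hk), splice_of_le _ _ (not_lt.1 hk)]; rfl

/-- The restriction of an invariant measure to a saturated set is invariant. -/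
lemma IsInvariantMeasure.restrict {X : Type*} [MeasurableSpace X] {R : X → X → Prop}
    {μ : Measure X} (hμ : IsInvariantMeasure R μ) {A : Set X} (hA : MeasurableSet A)
    (hsat : ∀ x y, R x y → (x ∈ A ↔ y ∈ A)) : IsInvariantMeasure R (μ.restrict A) := by
  intro B g hg
  rw [Measure.restrict_apply' hA, Measure.restrict_apply' hA]
  let ι : ↥(B ∩ A) → B := fun x => ⟨x.1, x.2.1⟩
  have h := hμ (B ∩ A) (g ∘ ι)
    { measurableSet := hg.measurableSet.inter hA
      measurable := hg.measurable.comp measurable_subtype_coe.subtype_mk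
      injective := hg.injective.comp fun x y hxy => Subtype.ext (congrArg (fun z : B => z.1) hxy)
      rel := fun x => hg.rel (ι x) }
  rw [h]
  congr 1
  ext y
  constructor
  · rintro ⟨x, rfl⟩
    exact ⟨⟨ι x, rfl⟩, (hsat _ _ (hg.rel (ι x))).1 x.2.2⟩
  · rintro ⟨⟨x, rfl⟩, hy⟩
    exact ⟨⟨x.1, x.2, (hsat _ _ (hg.rel x)).2 hy⟩, rfl⟩

variable [NeZero m]

/-- The pullback of the Bernoulli measure under Krieger's map. -/
noncomputable def dyckMeasure (m : ℕ) [NeZero m] : Measure (OneSidedShift m) :=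
  (bernoulli m).map kriegerSection

instance : IsProbabilityMeasure (dyckMeasure m) :=
  Measure.isProbabilityMeasure_map measurable_kriegerSection.aemeasurable

lemma kriegerMap_image_inter_Gminus (A : Set (OneSidedShift m)) :
    kriegerMap m '' (A ∩ Gminus m) = kriegerSection ⁻¹' A ∩ ThetaMinus m := by
  ext x
  constructor
  · rintro ⟨y, ⟨hyA, hy⟩, rfl⟩
    exact ⟨by rwa [Set.mem_preimage, kriegerSection_kriegerMap hy],
      (kriegerMap_mem_ThetaMinus_iff y).2 hy⟩
  · rintro ⟨hxA, hx⟩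
    refine ⟨kriegerSection x, ⟨hxA, ?_⟩, kriegerMap_kriegerSection x⟩
    rwa [← kriegerMap_mem_ThetaMinus_iff, kriegerMap_kriegerSection]

theorem dyckMeasure_apply (hm : 2 ≤ m) {A : Set (OneSidedShift m)} (hA : MeasurableSet A) :
    dyckMeasure m A = bernoulli m (kriegerMap m '' (A ∩ Gminus m)) := by
  rw [dyckMeasure, Measure.map_apply measurable_kriegerSection hA, kriegerMap_image_inter_Gminus,
    measure_inter_conull (bernoulli_compl_ThetaMinus hm)]

/-- Exchanging prefixes preserves the measure. -/
lemma dyckMeasure_splice (hm : 2 ≤ m) {S S' : Set (OneSidedShift m)} (hS : MeasurableSet S)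
    (hS' : MeasurableSet S') {n : ℕ} {v v' : ℕ → Letter m} (hv : ∀ y ∈ S, ∀ k < n, y.1 k = v k)
    (hSS' : ∀ y ∈ S, ∃ z ∈ S', z.1 = splice n v' y.1)
    (hS'S : ∀ z ∈ S', ∃ y ∈ S, z.1 = splice n v' y.1) : dyckMeasure m S = dyckMeasure m S' := by
  rw [dyckMeasure_apply hm hS, dyckMeasure_apply hm hS', kriegerMap_image_inter_Gminus,
    kriegerMap_image_inter_Gminus]
  set w : ℕ → ThetaLetter m := fun k => (v k).forget
  set w' : ℕ → ThetaLetter m := fun k => (v' k).forget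
  have hmeas : MeasurableSet (kriegerSection ⁻¹' S' ∩ ThetaMinus m) :=
    (measurable_kriegerSection hS').inter measurableSet_ThetaMinus
  have hsub : kriegerSection ⁻¹' S' ∩ ThetaMinus m ⊆ PiNat.cylinder w' n := by
    rintro x ⟨hx, -⟩ k hk
    obtain ⟨y, -, hy⟩ := hS'S _ hx
    rw [← kriegerMap_kriegerSection x, kriegerMap_splice hy, splice_of_lt _ _ hk]
  have htail (x : ℕ → ThetaLetter m) : splice n w' x ∈ ThetaMinus m ↔ x ∈ ThetaMinus m :=
    mem_ThetaMinus_congr fun k hk => splice_of_le w' x hk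
  rw [← Set.inter_eq_self_of_subset_left hsub, ← Measure.restrict_apply hmeas,
    bernoulli_restrict_cylinder w w' n, Measure.map_apply (measurable_splice n w') hmeas,
    Measure.restrict_apply (measurable_splice n w' hmeas)]
  congr 1
  ext x
  constructor
  · rintro ⟨hx, hxm⟩
    obtain ⟨z, hz, hzy⟩ := hSS' _ hx
    have hgz := kriegerMap_splice hzy
    rw [kriegerMap_kriegerSection] at hgz
    have hsm := (htail x).2 hxm
    refine ⟨⟨?_, hsm⟩, fun k hk => ?_⟩
    -- Being in `Gminus`, `z` is recovered from its image, so membership in `S'` passes to the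
    -- section of the spliced sequence.
    · have : z ∈ Gminus m := by rwa [← kriegerMap_mem_ThetaMinus_iff, hgz]
      rwa [Set.mem_preimage, ← hgz, kriegerSection_kriegerMap this]
    · rw [← kriegerMap_kriegerSection x, kriegerMap, hv _ hx k hk]
  · rintro ⟨⟨hx, hxm⟩, hxc⟩
    have hxm' := (htail x).1 hxm
    obtain ⟨y, hy, hzy⟩ := hS'S _ hx
    have hgz := kriegerMap_splice hzy
    rw [kriegerMap_kriegerSection] at hgz
    have hxy : kriegerMap m y = x := by
      funext k
      rcases Nat.lt_or_ge k n with hk | hk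
      · rw [hxc k hk, kriegerMap, hv y hy k hk]
      · have := congrFun hgz k
        rwa [splice_of_le _ _ hk, splice_of_le _ _ hk, eq_comm] at this
    refine ⟨?_, hxm'⟩
    have : y ∈ Gminus m := by rwa [← kriegerMap_mem_ThetaMinus_iff, hxy]
    rwa [Set.mem_preimage, ← hxy, kriegerSection_kriegerMap this]

/-- A holonomy changes finitely many letters of each point, so its domain is covered by countably
many pieces on which it exchanges one fixed prefix for another. -/
theorem isInvariantMeasure_dyckMeasure (hm : 2 ≤ m) :
    IsInvariantMeasure (TailRel m) (dyckMeasure m) := by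
  intro A g hg
  have : StandardBorelSpace A := hg.measurableSet.standardBorel
  -- Lusin–Souslin: an injective Borel map between standard Borel spaces has Borel images.
  have hgm : MeasurableEmbedding g := hg.measurable.measurableEmbedding hg.injective
  have hcm : MeasurableEmbedding (Subtype.val : A → OneSidedShift m) :=
    MeasurableEmbedding.subtype_coe hg.measurableSet
  -- Prefixes are indexed by lists so that there are countably many pieces; the default of `getD`
  -- only makes them total.
  let T : ℕ × List (Letter m) × List (Letter m) → Set A := fun p =>
    {y | (∀ k < p.1, y.1.1 k = p.2.1.getD k (.α 0)) ∧
      (∀ k < p.1, (g y).1 k = p.2.2.getD k (.α 0)) ∧ ∀ k ≥ p.1, (g y).1 k = y.1.1 k}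
  have hy1 (k : ℕ) : Measurable fun y : A => y.1.1 k :=
    (measurable_pi_apply k).comp (measurable_subtype_coe.comp measurable_subtype_coe)
  have hy2 (k : ℕ) : Measurable fun y : A => (g y).1 k :=
    (measurable_pi_apply k).comp (measurable_subtype_coe.comp hg.measurable)
  have hT (p) : MeasurableSet (T p) := by
    refine measurableSet_setOfPred.2 (Measurable.and ?_ (Measurable.and ?_ ?_)) <;>
      refine Measurable.forall fun k => measurable_const.imp (measurableSet_setOfPred.1 ?_)
    · exact measurableSet_eq_fun (hy1 k) measurable_const
    · exact measurableSet_eq_fun (hy2 k) measurable_const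
    · exact measurableSet_eq_fun (hy2 k) (hy1 k)
  have hcover : ⋃ p, T p = Set.univ := by
    refine Set.eq_univ_of_forall fun y => Set.mem_iUnion.2 ?_
    obtain ⟨n, hn⟩ := hg.rel y
    refine ⟨⟨n + 1, (List.range (n + 1)).map y.1.1, (List.range (n + 1)).map (g y).1⟩, ?_, ?_, ?_⟩
    · intro k hk
      simp [List.getD_eq_getElem?_getD, show k < n + 1 from hk]
    · intro k hk
      simp [List.getD_eq_getElem?_getD, show k < n + 1 from hk]
    · exact fun k hk => (hn k hk).symm
  have key : (dyckMeasure m).comap (Subtype.val : A → OneSidedShift m) =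
      (dyckMeasure m).comap g := by
    -- The pieces may overlap. Comparing two measures on `A` piece by piece needs only a countable
    -- cover.
    rw [Measure.ext_iff_of_iUnion_eq_univ hcover]
    rintro ⟨n, l, l'⟩
    ext s hs
    rw [Measure.restrict_apply hs, Measure.restrict_apply hs, hcm.comap_apply, hgm.comap_apply]
    have hsT := hs.inter (hT ⟨n, l, l'⟩)
    have hspl : ∀ y ∈ T ⟨n, l, l'⟩, (g y).1 = splice n (fun k => l'.getD k (.α 0)) y.1.1 := by
      rintro y ⟨-, h2, h3⟩
      funext k
      rcases Nat.lt_or_ge k n with hk | hk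
      · rw [splice_of_lt _ _ hk]; exact h2 k hk
      · rw [splice_of_le _ _ hk]; exact h3 k hk
    refine dyckMeasure_splice hm (hcm.measurableSet_image.2 hsT) (hgm.measurableSet_image.2 hsT)
      (n := n) (v := fun k => l.getD k (.α 0)) (v' := fun k => l'.getD k (.α 0)) ?_ ?_ ?_
    · rintro _ ⟨y, hy, rfl⟩
      exact hy.2.1
    · rintro _ ⟨y, hy, rfl⟩
      exact ⟨g y, ⟨y, hy, rfl⟩, hspl y hy.2⟩
    · rintro _ ⟨y, hy, rfl⟩
      exact ⟨y.1, ⟨y, hy, rfl⟩, hspl y hy.2⟩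
  have huniv := congrArg (fun κ : Measure A => κ Set.univ) key
  simpa only [hcm.comap_apply, hgm.comap_apply, Set.image_univ, Subtype.range_coe] using huniv

/-! ### Uniqueness and ergodicity -/

/-- The prefix `w` is exchanged for `w'` in the full shift and the result is relabelled. Since
`label` ignores the past, points of `Gminus` keep their letters from `n` on, so this is a tail move.
By symmetry the two masses are equal. -/
lemma IsInvariantMeasure.map_kriegerMap_cylinder_le {ν : Measure (OneSidedShift m)}
    [IsFiniteMeasure ν] (hν : IsInvariantMeasure (TailRel m) ν) (w w' : ℕ → ThetaLetter m)
    (n : ℕ) : ν.map (kriegerMap m) (PiNat.cylinder w n) ≤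
      ν.map (kriegerMap m) (PiNat.cylinder w' n) := by
  have hpre := measurable_kriegerMap (m := m) (measurableSet_cylinder w n)
  rw [Measure.map_apply measurable_kriegerMap (measurableSet_cylinder w n),
    Measure.map_apply measurable_kriegerMap (measurableSet_cylinder w' n),
    ← measure_inter_conull (measure_compl_Gminus hν)]
  have hforget : Measurable fun (y : ℕ → Letter m) k => (y k).forget :=
    measurable_pi_lambda _ fun k => measurable_comp_apply Letter.forget k
  refine hν.measure_le (hpre.inter measurableSet_Gminus)
    (f := fun y => label (splice n w' fun k => (y k).forget))
    (measurable_label.comp ((measurable_splice n w').comp hforget)) ?_ ?_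
  · rintro y ⟨-, hy⟩
    refine ⟨label_mem_shift _, ⟨n, fun k hk => ?_⟩, fun k hk => ?_⟩
    · refine Eq.trans ?_ (label_congr (x := kriegerMap m y) (n := n)
        (fun k hk => (splice_of_le w' (kriegerMap m y) hk).symm) k hk.le)
      exact (congrFun (congrArg Subtype.val (kriegerSection_kriegerMap hy)) k).symm
    · exact (forget_label _ k).trans (splice_of_lt _ _ hk)
  · rintro y ⟨hyc, hy⟩ z ⟨hzc, hz⟩ h
    rw [← kriegerSection_kriegerMap hy, ← kriegerSection_kriegerMap hz]
    congr 1
    funext k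
    rcases Nat.lt_or_ge k n with hk | hk
    · exact (hyc k hk).trans (hzc k hk).symm
    · have := congrArg Letter.forget (congrFun h k)
      rwa [forget_label, forget_label, splice_of_le _ _ hk, splice_of_le _ _ hk] at this

/-- Every finite invariant measure is a multiple of the Dyck measure. -/
theorem IsInvariantMeasure.eq_smul_dyckMeasure {ν : Measure (OneSidedShift m)}
    [IsFiniteMeasure ν] (hν : IsInvariantMeasure (TailRel m) ν) :
    ν = ν Set.univ • dyckMeasure m := by
  have hmap : ν.map (kriegerMap m) = ν Set.univ • bernoulli m := by
    refine measure_ext_of_cylinder fun w n => ?_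
    rw [measure_cylinder_of_uniform fun w w' n => le_antisymm
      (hν.map_kriegerMap_cylinder_le w w' n) (hν.map_kriegerMap_cylinder_le w' w n),
      Measure.smul_apply, bernoulli_cylinder, smul_eq_mul,
      Measure.map_apply measurable_kriegerMap MeasurableSet.univ, Set.preimage_univ]
  have hae : (kriegerSection ∘ kriegerMap m : OneSidedShift m → _) =ᵐ[ν] id := by
    filter_upwards [show Gminus m ∈ ae ν from measure_compl_Gminus hν] with y hy
    exact kriegerSection_kriegerMap hy
  calc ν = ν.map (kriegerSection ∘ kriegerMap m) := by rw [Measure.map_congr hae, Measure.map_id]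
    _ = (ν.map (kriegerMap m)).map kriegerSection :=
      (Measure.map_map measurable_kriegerSection measurable_kriegerMap).symm
    _ = ν Set.univ • dyckMeasure m := by rw [hmap, Measure.map_smul, dyckMeasure]

/-- The restriction to a saturated set `A` is invariant, hence a multiple of the whole measure with
factor the mass of `A`. Evaluating at `Aᶜ` makes the product of the two masses zero. -/
theorem isErgodicMeasure_dyckMeasure (hm : 2 ≤ m) :
    IsErgodicMeasure (TailRel m) (dyckMeasure m) := by
  intro A hA hsat
  have h := ((isInvariantMeasure_dyckMeasure hm).restrict hA hsat).eq_smul_dyckMeasure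
  have h' := congrArg (fun κ : Measure (OneSidedShift m) => κ Aᶜ) h
  simp only [Measure.restrict_apply hA.compl, Set.compl_inter_self, measure_empty,
    Measure.smul_apply, Measure.restrict_apply MeasurableSet.univ, Set.univ_inter,
    smul_eq_mul] at h'
  exact mul_eq_zero.1 h'.symm

end Dyck

theorem mainTheorem1 (m : ℕ) (hm : 2 ≤ m) :
    Dyck.IsUniquelyErgodic (Dyck.TailRel m) ∧
    ∃ μ : Measure (Dyck.OneSidedShift m),
      IsProbabilityMeasure μ ∧
      Dyck.IsInvariantMeasure (Dyck.TailRel m) μ ∧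
      Dyck.IsErgodicMeasure (Dyck.TailRel m) μ ∧
      (∀ ν : Measure (Dyck.OneSidedShift m),
        (ν ≠ 0 ∧ Dyck.IsTopologicallySigmaFinite ν ∧
            Dyck.IsInvariantMeasure (Dyck.TailRel m) ν) ↔
          ∃ c : NNReal, 0 < c ∧ ν = c • μ) ∧
      μ (Dyck.Gminus m)ᶜ = 0 ∧
      Set.BijOn (Dyck.kriegerMap m) (Dyck.Gminus m) (Dyck.ThetaMinus m) ∧
      ∀ A : Set (Dyck.OneSidedShift m), MeasurableSet A →
        μ A = Dyck.bernoulli m (Dyck.kriegerMap m '' (A ∩ Dyck.Gminus m)) := by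
  have : NeZero m := ⟨by omega⟩
  have hinv := Dyck.isInvariantMeasure_dyckMeasure hm
  refine ⟨⟨Dyck.dyckMeasure m, ⟨inferInstance, hinv⟩, ?_⟩, Dyck.dyckMeasure m, inferInstance, hinv,
    Dyck.isErgodicMeasure_dyckMeasure hm, fun ν => ⟨?_, ?_⟩, Dyck.measure_compl_Gminus hinv,
    Dyck.bijOn_kriegerMap, fun A hA => Dyck.dyckMeasure_apply hm hA⟩
  · rintro ν ⟨hprob, hν⟩
    rw [hν.eq_smul_dyckMeasure, measure_univ, one_smul]
  · rintro ⟨hne, hts, hν⟩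
    have := Dyck.isFiniteMeasure_of_isTopologicallySigmaFinite hν hts
    refine ⟨(ν Set.univ).toNNReal, ?_, ?_⟩
    · exact ENNReal.toNNReal_pos (Measure.measure_univ_ne_zero.2 hne) (measure_ne_top ν _)
    · conv_lhs => rw [hν.eq_smul_dyckMeasure, ← ENNReal.coe_toNNReal (measure_ne_top ν Set.univ)]
      rfl
  · rintro ⟨c, hc, rfl⟩
    refine ⟨fun h0 => ?_, ⟨∅, measure_empty, fun _ => Set.univ,
      fun _ => ⟨isOpen_univ, measure_lt_top _ _⟩, fun x _ => Set.mem_iUnion.2 ⟨0, trivial⟩⟩,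
      fun A g hg => ?_⟩
    · have := congrArg (fun κ : Measure (Dyck.OneSidedShift m) => κ Set.univ) h0
      simp at this
      exact hc.ne' this
    · rw [Measure.smul_apply, Measure.smul_apply, hinv A g hg]
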